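/- Conventions. Let $F$ be a field. A generalized layered graph $\Gamma$ consists of a set $V$ of vertices, a set $E$ of edges, maps $t,h:E\to V$ (tail and head) and a rank function $|\cdot|:V\to\mathbb Z_{\ge 0}$ with $|t(e)|>|h(e)|$ for all $e\in E$; put $l(e)=|t(e)|-|h(e)|$. A path from $v$ to $w$ is a sequence $\pi=(e_1,\dots,e_r)$, $r\ge 1$, of edges with $t(e_1)=v$, $h(e_r)=w$ and $h(e_j)=t(e_{j+1})$ for $1\le j<r$; write $v>w$ if such a path exists, and call $v$ minimal if there is no $w$ with $v>w$. Let $T$ be the free associative unital $F$-algebra on the symbols $a_j(e)$, $e\in E$, $1\le j\le l(e)$; put $a_0(e)=1$. With a central variable $t$ let $P_e(t)=\sum_{j=0}^{l(e)}(-1)^ja_j(e)t^j$ and, for a path $\pi=(e_1,\dots,e_r)$ from $v$ to $w$, let $P_\pi(t)=P_{e_1}(t)\cdots P_{e_r}(t)=\sum_{j\ge 0}(-1)^je(\pi,j)t^j$. The algebra $A(\Gamma)$ is the quotient of $T$ by the two-sided ideal generated by all $e(\pi_1,j)-e(\pi_2,j)$, where $\pi_1,\pi_2$ are paths with the same tail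 $v$ and the same head $w$, and $1\le j\le |v|-|w|$. **Theorem.** Let $\Gamma$ be a generalized layered graph with a unique minimal vertex. (a) Assume that the minimal vertices are exactly the vertices of rank $0$. For every vertex $v$ with $|v|>0$ choose an edge $e_v$ with tail $v$, let $\pi_v$ be the path starting at $v$ that follows the chosen edges down to the minimal vertex, and let $e(v,k)\in A(\Gamma)$ be the image of $e(\pi_v,k)$. Write $(v,k)\gtrdot(w,l)$ if $v>w$ and $k=|v|-|w|$. Let $\mathbf B(\Gamma)$ be the set of all finite sequences $((v_1,k_1),\dots,(v_r,k_r))$, $r\ge 0$, with $|v_j|>0$ and $1\le k_j\le|v_j|$, such that $(v_j,k_j)\gtrdot(v_{j+1},k_{j+1})$ for no $j$ with $1\le j<r$, and let $\epsilon$ send such a sequence to $e(v_1,k_1)\cdots e(v_r,k_r)\in A(\Gamma)$. Then, for any such choice of the edges $e_v$, the family $(\epsilon(b))_{b\in\mathbf B(\Gamma)}$ is a basis of the $F$-vector space $A(\Gamma)$. (b) Let $e\in E$ and let $i$ be an integer with $0<i<l(e)$. Let $\Gamma^w$ be the generalized layered graph obtained from $\Gamma$ by adding a vertex $w$ of rank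 $|h(e)|+i$ and replacing $e$ by two edges $e_1$, from $t(e)$ to $w$, and $e_2$, from $w$ to $h(e)$. Then the algebra homomorphism $\iota:A(\Gamma)\to A(\Gamma^w)$ induced by $a_j(f)\mapsto a_j(f)$ for $f\ne e$, $1\le j\le l(f)$, and $$a_j(e)\mapsto\sum_{\max(0,\,i+j-l(e))\le k\le\min(i,j)}a_{j-k}(e_1)\,a_k(e_2)\qquad(1\le j\le l(e))$$ (that is, $P_e(t)\mapsto P_{e_1}(t)P_{e_2}(t)$) is well defined and injective. -/

import Mathlib

noncomputable section

/-- A generalized layered graph: a directed graph with vertex set `V`, edge set `E` (loops are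
impossible, multiple edges are allowed, nothing has to be finite) and a rank function that
strictly decreases along every edge. -/
structure GenLayeredGraph (V E : Type*) where
  tail : E → V
  head : E → V
  rank : V → ℕ
  rank_lt : ∀ e, rank (head e) < rank (tail e)

namespace GenLayeredGraph

open Finset Polynomial

variable {V E : Type*} (Γ : GenLayeredGraph V E) (F : Type*) [Field F]

/-- The length of an edge (the subtraction never truncates, by `rank_lt`). -/
def len (e : E) : ℕ := Γ.rank (Γ.tail e) - Γ.rank (Γ.head e)

/-- `Γ.IsPath v w π`: the nonempty list of edges `π` is a directed path from `v` to `w`. -/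
inductive IsPath : V → V → List E → Prop
  | single (e : E) : IsPath (Γ.tail e) (Γ.head e) [e]
  | cons (e : E) {w : V} {π : List E} (h : IsPath (Γ.head e) w π) :
      IsPath (Γ.tail e) w (e :: π)

/-- The strict order `v > w` on vertices: there is a directed path from `v` to `w`. -/
def Above (v w : V) : Prop := ∃ π, Γ.IsPath v w π

/-- A vertex is minimal if no vertex lies strictly below it. -/
def IsMinimal (v : V) : Prop := ∀ w, ¬ Γ.Above v w

/-! ### The algebra `A(Γ)` -/

/-- The set `E^♯` of pairs `(e, i)` with `1 ≤ i ≤ l(e)`. -/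
abbrev ESharp : Type _ := {p : E × ℕ // 1 ≤ p.2 ∧ p.2 ≤ Γ.len p.1}

/-- The element `a_j(e)` of the free algebra `T(E^♯)`: the generator `(e, j)` for
`1 ≤ j ≤ l(e)`, with the conventions `a_0(e) = 1` and `a_j(e) = 0` for `j > l(e)`. -/
def a (e : E) (j : ℕ) : FreeAlgebra F Γ.ESharp :=
  if j = 0 then 1
  else if h : 1 ≤ j ∧ j ≤ Γ.len e then FreeAlgebra.ι F (⟨(e, j), h⟩ : Γ.ESharp)
  else 0

/-- `P_e(t) = 1 + ∑_{j=1}^{l(e)} (-1)^j a_j(e) t^j`, with `t` central. -/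
def edgePoly (e : E) : (FreeAlgebra F Γ.ESharp)[X] :=
  1 + ∑ j ∈ Icc 1 (Γ.len e), C ((-1) ^ j * Γ.a F e j) * X ^ j

/-- `P_π(t)`, the ordered product of the `P_e(t)` along the list of edges `π`. -/
def pathPoly (π : List E) : (FreeAlgebra F Γ.ESharp)[X] :=
  (π.map (Γ.edgePoly F)).prod

/-- The element `e(π, j)` of `T(E^♯)`, i.e. `(-1)^j` times the coefficient of `t^j`
in `P_π(t)`. -/
def pathCoeff (π : List E) (j : ℕ) : FreeAlgebra F Γ.ESharp :=
  (-1) ^ j * (Γ.pathPoly F π).coeff j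

/-- The defining relations of `A(Γ)`: `e(π₁, j) = e(π₂, j)` for paths `π₁`, `π₂` with the same
tail `v` and the same head `w`, and `1 ≤ j ≤ l(π₁) = |v| - |w|`. -/
inductive Rel : FreeAlgebra F Γ.ESharp → FreeAlgebra F Γ.ESharp → Prop
  | mk {v w : V} {π₁ π₂ : List E} (h₁ : Γ.IsPath v w π₁) (h₂ : Γ.IsPath v w π₂) (j : ℕ)
      (hj : 1 ≤ j) (hjl : j ≤ Γ.rank v - Γ.rank w) :
      Rel (Γ.pathCoeff F π₁ j) (Γ.pathCoeff F π₂ j)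

/-- `A(Γ)`: the quotient of `T(E^♯)` by the two-sided ideal generated by the differences of the
two sides of the defining relations. -/
abbrev A : Type _ := RingQuot (Γ.Rel F)

/-- The quotient map `T(E^♯) → A(Γ)`. -/
def toA : FreeAlgebra F Γ.ESharp →ₐ[F] Γ.A F := RingQuot.mkAlgHom F (Γ.Rel F)

/-! ### The monomials `ε(B(Γ))` -/

/-- A choice, for every vertex `v` of positive rank, of an edge `e_v` with tail `v`. -/
structure EdgeChoice where
  edge : (v : V) → Γ.rank v ≠ 0 → E
  tail_edge : ∀ v h, Γ.tail (edge v h) = v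

variable {Γ} in
/-- The path `π_v` that starts with `e_v` and continues with `π_{h(e_v)}` until a vertex of
rank zero is reached (the empty list if `v` itself has rank zero). -/
def EdgeChoice.path (c : Γ.EdgeChoice) (v : V) : List E :=
  if h : Γ.rank v = 0 then []
  else c.edge v h :: c.path (Γ.head (c.edge v h))
termination_by Γ.rank v
decreasing_by
  have := Γ.rank_lt (c.edge v h)
  rwa [c.tail_edge v h] at this

/-- The set `V^♯` of pairs `(v, k)` with `v` of positive rank and `1 ≤ k ≤ |v|`. -/
abbrev VSharp : Type _ := {p : V × ℕ // 1 ≤ p.2 ∧ p.2 ≤ Γ.rank p.1}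

/-- The relation `(v, k) ⋗ (w, l)`: `v > w` and `k = |v| - |w|`. -/
def GtrDot (p q : V × ℕ) : Prop :=
  Γ.Above p.1 q.1 ∧ (p.2 : ℤ) = (Γ.rank p.1 : ℤ) - (Γ.rank q.1 : ℤ)

/-- `B(Γ)`: the finite sequences in `V^♯` (the empty one included) in which no consecutive pair
satisfies `(v_j, k_j) ⋗ (v_{j+1}, k_{j+1})`. -/
def B : Set (List Γ.VSharp) :=
  {b | b.IsChain fun p q => ¬ Γ.GtrDot p.1 q.1}

variable {Γ} in
/-- The element `e(v, k) = e(π_v, k)` of `A(Γ)`. -/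
def EdgeChoice.elt (c : Γ.EdgeChoice) (v : V) (k : ℕ) : Γ.A F :=
  Γ.toA F (Γ.pathCoeff F (c.path v) k)

variable {Γ} in
/-- `ε((v_1, k_1), …, (v_r, k_r)) = e(v_1, k_1) ⋯ e(v_r, k_r)`. -/
def EdgeChoice.eps (c : Γ.EdgeChoice) (b : List Γ.VSharp) : Γ.A F :=
  (b.map fun p => c.elt F p.1.1 p.1.2).prod

/-! ### Placing a new vertex on an edge -/

/-- The edges of the graph in which `e` is subdivided: the edges other than `e`, and the two
halves of `e`. -/
inductive SubEdge (e : E) : Type _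
  | old (f : E) (hf : f ≠ e) : SubEdge e
  | fst : SubEdge e
  | snd : SubEdge e

/-- The graph `Γ^w` obtained by placing a new vertex `w = none` of rank `|h(e)| + i` on the
edge `e`, where `0 < i < l(e)`. The edge `e₁ = fst` goes from `t(e)` to `w` and the edge
`e₂ = snd` from `w` to `h(e)`. -/
def addVertex (e : E) (i : ℕ) (hi : 0 < i) (hil : i < Γ.len e) :
    GenLayeredGraph (Option V) (SubEdge e) where
  tail
    | .old f _ => some (Γ.tail f)
    | .fst => some (Γ.tail e)
    | .snd => none
  head
    | .old f _ => some (Γ.head f)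
    | .fst => none
    | .snd => some (Γ.head e)
  rank
    | some v => Γ.rank v
    | none => Γ.rank (Γ.head e) + i
  rank_lt
    | .old f _ => Γ.rank_lt f
    | .fst => by have := hil; simp only [len] at this ⊢; omega
    | .snd => by simp only; omega

variable (e : E) (i : ℕ) (hi : 0 < i) (hil : i < Γ.len e)

open Classical in
/-- The images of the generators: `a_j(f) ↦ a_j(f)` for `f ≠ e`, and
`a_j(e) ↦ ∑ a_{j-k}(e₁) a_k(e₂)` over `max(0, i + j - l(e)) ≤ k ≤ min(i, j)`. -/
def iotaGen (p : Γ.ESharp) : FreeAlgebra F (Γ.addVertex e i hi hil).ESharp :=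
  if h : p.1.1 = e then
    ∑ k ∈ Icc (i + p.1.2 - Γ.len e) (min i p.1.2),
      (Γ.addVertex e i hi hil).a F .fst (p.1.2 - k) * (Γ.addVertex e i hi hil).a F .snd k
  else (Γ.addVertex e i hi hil).a F (.old p.1.1 h) p.1.2

/-- The homomorphism `T(E^♯) → T(E^{w♯})` given by the images of the generators. -/
def iotaTilde :
    FreeAlgebra F Γ.ESharp →ₐ[F] FreeAlgebra F (Γ.addVertex e i hi hil).ESharp :=
  FreeAlgebra.lift F (Γ.iotaGen F e i hi hil)

/-! Helper facts: the homomorphism above respects the defining relations. -/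

open Classical in
/-- The path of `Γ^w` that corresponds to a path of `Γ`. -/
def subPath (π : List E) : List (SubEdge e) :=
  π.flatMap fun f => if h : f = e then [.fst, .snd] else [.old f h]

theorem a_of_lt (f : E) {j : ℕ} (h : Γ.len f < j) : Γ.a F f j = 0 := by
  unfold a
  rw [if_neg (by omega), dif_neg (by omega)]

theorem coeff_edgePoly (f : E) (j : ℕ) :
    (Γ.edgePoly F f).coeff j = (-1) ^ j * Γ.a F f j := by
  unfold edgePoly
  simp only [coeff_add, finsetSum_coeff, coeff_C_mul, coeff_X_pow, coeff_one, mul_ite, mul_one,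
    mul_zero, Finset.sum_ite_eq, Finset.mem_Icc]
  by_cases h0 : j = 0
  · simp [h0, a]
  · by_cases hj : j ≤ Γ.len f
    · rw [if_neg (by omega), if_pos (by omega), zero_add]
    · rw [if_neg (by omega), if_neg (by omega), a_of_lt Γ F f (by omega)]
      simp

theorem len_old (f : E) (hf : f ≠ e) :
    (Γ.addVertex e i hi hil).len (.old f hf) = Γ.len f := rfl

theorem len_fst : (Γ.addVertex e i hi hil).len .fst = Γ.len e - i := by
  simp only [len, addVertex]; omega

theorem len_snd : (Γ.addVertex e i hi hil).len .snd = i := by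
  simp only [len, addVertex]; omega

theorem iotaTilde_a_old (f : E) (hf : f ≠ e) (j : ℕ) :
    Γ.iotaTilde F e i hi hil (Γ.a F f j) = (Γ.addVertex e i hi hil).a F (.old f hf) j := by
  by_cases h0 : j = 0
  · simp [a, h0]
  · by_cases hj : j ≤ Γ.len f
    · rw [a, if_neg h0, dif_pos ⟨by omega, hj⟩, iotaTilde, FreeAlgebra.lift_ι_apply, iotaGen,
        dif_neg hf]
    · rw [a_of_lt Γ F f (by omega), a_of_lt _ F _ (by rw [len_old]; omega), map_zero]

theorem iotaTilde_a_self (j : ℕ) :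
    Γ.iotaTilde F e i hi hil (Γ.a F e j) =
      ∑ p ∈ antidiagonal j, (Γ.addVertex e i hi hil).a F .fst p.1 *
        (Γ.addVertex e i hi hil).a F .snd p.2 := by
  by_cases h0 : j = 0
  · simp [a, h0]
  · by_cases hj : j ≤ Γ.len e
    · rw [a, if_neg h0, dif_pos ⟨by omega, hj⟩, iotaTilde, FreeAlgebra.lift_ι_apply, iotaGen,
        dif_pos rfl, ← Finset.Nat.sum_antidiagonal_swap,
        Finset.Nat.sum_antidiagonal_eq_sum_range_succ_mk]
      apply Finset.sum_subset
      · intro k hk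
        simp only [Finset.mem_Icc, Finset.mem_range] at hk ⊢
        omega
      · intro k hk hk'
        simp only [Finset.mem_Icc, Finset.mem_range] at hk hk'
        by_cases hki : i < k
        · rw [a_of_lt _ F SubEdge.snd (by rw [len_snd]; exact hki), mul_zero]
        · rw [a_of_lt _ F SubEdge.fst (by rw [len_fst]; change _ < j - k; omega), zero_mul]
    · rw [a_of_lt Γ F e (by omega), map_zero]
      symm
      apply Finset.sum_eq_zero
      intro p hp
      rw [HasAntidiagonal.mem_antidiagonal] at hp
      by_cases hki : i < p.2
      · rw [a_of_lt _ F SubEdge.snd (by rw [len_snd]; exact hki), mul_zero]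
      · rw [a_of_lt _ F SubEdge.fst (by rw [len_fst]; omega), zero_mul]

theorem map_edgePoly_old (f : E) (hf : f ≠ e) :
    (Γ.edgePoly F f).map (Γ.iotaTilde F e i hi hil : _ →+* _) =
      (Γ.addVertex e i hi hil).edgePoly F (.old f hf) := by
  ext j
  rw [coeff_map, coeff_edgePoly, coeff_edgePoly, ← iotaTilde_a_old]
  simp

theorem map_edgePoly_self :
    (Γ.edgePoly F e).map (Γ.iotaTilde F e i hi hil : _ →+* _) =
      (Γ.addVertex e i hi hil).edgePoly F .fst * (Γ.addVertex e i hi hil).edgePoly F .snd := by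
  ext j
  rw [coeff_map, coeff_edgePoly, coeff_mul]
  simp only [coeff_edgePoly, RingHom.coe_coe, map_mul, map_pow, map_neg, map_one,
    iotaTilde_a_self, Finset.mul_sum]
  apply Finset.sum_congr rfl
  intro p hp
  rw [HasAntidiagonal.mem_antidiagonal] at hp
  rw [← hp, pow_add, mul_assoc, mul_assoc, ← mul_assoc ((-1) ^ p.2), ← mul_assoc (a _ _ _ _),
    ((Commute.neg_one_left _).pow_left p.2).eq]

theorem map_pathPoly (π : List E) :
    (Γ.pathPoly F π).map (Γ.iotaTilde F e i hi hil : _ →+* _) =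
      (Γ.addVertex e i hi hil).pathPoly F (subPath e π) := by
  induction π with
  | nil => simp [pathPoly, subPath]
  | cons f π ih =>
    have h1 : Γ.pathPoly F (f :: π) = Γ.edgePoly F f * Γ.pathPoly F π := by simp [pathPoly]
    rw [h1, Polynomial.map_mul, ih]
    by_cases h : f = e
    · subst h
      rw [map_edgePoly_self]
      simp [pathPoly, subPath, mul_assoc]
    · rw [map_edgePoly_old Γ F e i hi hil f h]
      simp [pathPoly, subPath, h]

theorem iotaTilde_pathCoeff (π : List E) (j : ℕ) :
    Γ.iotaTilde F e i hi hil (Γ.pathCoeff F π j) =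
      (Γ.addVertex e i hi hil).pathCoeff F (subPath e π) j := by
  unfold pathCoeff
  rw [← map_pathPoly, coeff_map]
  simp

theorem isPath_subPath {v w : V} {π : List E} (h : Γ.IsPath v w π) :
    (Γ.addVertex e i hi hil).IsPath (some v) (some w) (subPath e π) := by
  induction h with
  | single f =>
    by_cases hf : f = e
    · subst hf
      have : (Γ.addVertex f i hi hil).IsPath (some (Γ.tail f)) (some (Γ.head f))
          [.fst, .snd] := IsPath.cons (Γ := Γ.addVertex f i hi hil) SubEdge.fst
        (IsPath.single (Γ := Γ.addVertex f i hi hil) SubEdge.snd)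
      simpa [subPath] using this
    · have : (Γ.addVertex e i hi hil).IsPath (some (Γ.tail f)) (some (Γ.head f))
          [.old f hf] := IsPath.single (Γ := Γ.addVertex e i hi hil) (SubEdge.old f hf)
      simpa [subPath, hf] using this
  | @cons f w π h ih =>
    by_cases hf : f = e
    · subst hf
      have : (Γ.addVertex f i hi hil).IsPath (some (Γ.tail f)) (some w)
          (.fst :: .snd :: subPath f π) := IsPath.cons (Γ := Γ.addVertex f i hi hil) SubEdge.fst
        (IsPath.cons (Γ := Γ.addVertex f i hi hil) SubEdge.snd ih)
      simpa [subPath] using this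
    · have : (Γ.addVertex e i hi hil).IsPath (some (Γ.tail f)) (some w)
          (.old f hf :: subPath e π) := IsPath.cons (Γ := Γ.addVertex e i hi hil) (SubEdge.old f hf) ih
      simpa [subPath, hf] using this

theorem iotaTilde_rel ⦃x y : FreeAlgebra F Γ.ESharp⦄ (h : Γ.Rel F x y) :
    ((Γ.addVertex e i hi hil).toA F).comp (Γ.iotaTilde F e i hi hil) x =
      ((Γ.addVertex e i hi hil).toA F).comp (Γ.iotaTilde F e i hi hil) y := by
  obtain ⟨h₁, h₂, j, hj, hjl⟩ := h
  simp only [AlgHom.comp_apply, iotaTilde_pathCoeff]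
  exact RingQuot.mkAlgHom_rel F
    (Rel.mk (Γ.isPath_subPath e i hi hil h₁) (Γ.isPath_subPath e i hi hil h₂) j hj hjl)

/-- The homomorphism `ι : A(Γ) → A(Γ^w)` induced by `iotaTilde`. -/
def iota : Γ.A F →ₐ[F] (Γ.addVertex e i hi hil).A F :=
  RingQuot.liftAlgHom F
    ⟨((Γ.addVertex e i hi hil).toA F).comp (Γ.iotaTilde F e i hi hil),
      Γ.iotaTilde_rel F e i hi hil⟩

end GenLayeredGraph

end

noncomputable section

/-! ### Words in the letters `(v, k)`

Words are written in reverse order, so that `p :: l` is the word `l` followed by the letter `p`. -/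

namespace LayeredWords

open Finset Polynomial

variable {V : Type*} (R : V → V → Prop) (ht : V → ℕ)

/-! Measure ranks from the minimal vertex m. Over A(Γ) the polynomials p_v = ∑ e(v,k) t^(|v|-k) are
monic, and a path from v to w gives p_v = q p_w, where q is the reversed sign-free path polynomial.
The defining relations say that q depends only on v and w.

Both halves of (a) come from one division algorithm, carried out formally on W[t], where W has the
admissible words as basis. The multiples s p_v are modelled by `multiples v`, spanned by the shifts
of l p_x with x = v or x > v and l free for x. To reduce l t^c when l is free for v, use p_v. If l =
l'(x,k) would form a forbidden pair with v, use p_x instead: it trades the word for the shorter l'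
and for words l'(x,i) with i ≠ k, which are free for v. The outcome is a linear projection `remLin`
onto polynomials of degree less than |v|, with kernel `multiples v` (`remLin_eq_zero`,
`sub_remLin_mem`, `remLin_of_lt`).

Independence: subtracting from x t^|v| its remainder defines a monic polynomial P_v (`vertexPoly`)
with coefficients in End W. Uniqueness of remainders gives P_w ∣ P_v for v > w (`vertexPoly_dvd`).
The quotients along edges define a right action of A(Γ) on W; the relations hold because a monic P_w
can be cancelled. Each word, evaluated in A(Γ), takes the empty word to its own basis vector
(`evalNil_wordElt`).

Spanning: mapping the same remainders to A(Γ)[t] expresses (word) · e(v,k) through admissible words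
(`wordElt_mul_mem_range`), so their span is a right ideal containing 1.

The argument works for any choice of paths down to m and does not need |m| = 0. This gives (b): ι
only renames the letters of admissible words, so it maps a basis injectively into a basis. -/

/-- No letter `(v, k)` completes a forbidden pair with the last letter of `l`. -/
def Free (v : V) : List (V × ℕ) → Prop
  | [] => True
  | p :: _ => ¬ (R p.1 v ∧ p.2 + ht v = ht p.1)

/-- The words without forbidden consecutive pairs. -/
def Valid : List (V × ℕ) → Prop
  | [] => True
  | p :: l => (1 ≤ p.2 ∧ p.2 ≤ ht p.1) ∧ Free R ht p.1 l ∧ Valid l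

/-- The type of words without forbidden consecutive pairs. -/
abbrev Word : Type _ := {l : List (V × ℕ) // Valid R ht l}

variable (F : Type*) [Field F]

/-- The vector space on the valid words. -/
def WordSpace : Type _ := Word R ht →₀ F

instance : AddCommGroup (WordSpace R ht F) := inferInstanceAs (AddCommGroup (Word R ht →₀ F))

instance : Module F (WordSpace R ht F) := inferInstanceAs (Module F (Word R ht →₀ F))

/-- The basis of `WordSpace` that consists of the valid words. -/
def wordBasis : Module.Basis (Word R ht) F (WordSpace R ht F) :=
  ⟨LinearEquiv.refl F (Word R ht →₀ F)⟩

/-- The polynomials in a central variable with coefficients in `WordSpace`. -/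
abbrev WordPoly : Type _ := ℕ →₀ WordSpace R ht F

open Classical in
/-- The basis vector of a word (zero if the word is not valid). -/
def vec (l : List (V × ℕ)) : WordSpace R ht F :=
  if h : Valid R ht l then wordBasis R ht F ⟨l, h⟩ else 0

theorem vec_word (b : Word R ht) : vec R ht F b.1 = wordBasis R ht F b := by
  rw [vec, dif_pos b.2]

/-- `t ^ c` times the polynomial `∑ i, (l, (v, i)) t ^ (|v| - i)`, where the term for `i = 0`
is `l t ^ |v|`. -/
def gen (v : V) (c : ℕ) (l : List (V × ℕ)) : WordPoly R ht F :=
  Finsupp.single (c + ht v) (vec R ht F l) +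
    ∑ i ∈ Icc 1 (ht v), Finsupp.single (c + ht v - i) (vec R ht F ((v, i) :: l))

/-- The submodule of right multiples of the polynomial attached to `v`. -/
def multiples (v : V) : Submodule F (WordPoly R ht F) :=
  Submodule.span F {z | ∃ x c l, (x = v ∨ R x v) ∧ Free R ht x l ∧ Valid R ht l ∧
    z = gen R ht F x c l}

/-- The remainder of `l t ^ c` modulo `multiples v`, for `l` free with respect to `v`. -/
def freeRem (v : V) (c : ℕ) (l : List (V × ℕ)) : WordPoly R ht F :=
  if c < ht v then Finsupp.single c (vec R ht F l)
  else -∑ i : Fin (ht v), freeRem v (c - (i + 1)) ((v, (i : ℕ) + 1) :: l)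
termination_by c
decreasing_by
  have := i.2
  omega

open Classical in
/-- The remainder of `l t ^ c` modulo `multiples v`. -/
def rem (v : V) : List (V × ℕ) → ℕ → WordPoly R ht F
  | [], c => freeRem R ht F v c []
  | p :: l, c =>
    if c < ht v then Finsupp.single c (vec R ht F (p :: l))
    -- In the relation of `p.1` shifted by `c - ht v`, this word occurs with exponent exactly `c`
    -- and the leading term has exponent `c + p.2`; solve for this word.
    else if R p.1 v ∧ p.2 + ht v = ht p.1 then
      -(rem v l (c + p.2) + ∑ i ∈ (Icc 1 (ht p.1)).erase p.2,
        freeRem R ht F v (c + p.2 - i) ((p.1, i) :: l))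
    else freeRem R ht F v c (p :: l)

/-- The linear map that takes remainders modulo `multiples v`. -/
def remLin (v : V) : WordPoly R ht F →ₗ[F] WordPoly R ht F :=
  Finsupp.lsum F fun c => (wordBasis R ht F).constr F fun b => rem R ht F v b.1 c

/-! ### Division with remainder modulo `multiples v` -/

variable {R ht F}

theorem freeRem_of_lt {v : V} {c : ℕ} (h : c < ht v) (l : List (V × ℕ)) :
    freeRem R ht F v c l = Finsupp.single c (vec R ht F l) := by
  rw [freeRem, if_pos h]

theorem freeRem_of_le {v : V} {c : ℕ} (h : ht v ≤ c) (l : List (V × ℕ)) :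
    freeRem R ht F v c l =
      -∑ i ∈ Icc 1 (ht v), freeRem R ht F v (c - i) ((v, i) :: l) := by
  rw [freeRem, if_neg (by omega), ← Finset.sum_range fun i => freeRem R ht F v (c - (i + 1)) ((v, i + 1) :: l),
    Finset.range_eq_Ico, Finset.sum_Ico_add' (fun i => freeRem R ht F v (c - i) ((v, i) :: l)),
    zero_add, Finset.Ico_add_one_right_eq_Icc]

theorem rem_of_lt {v : V} {c : ℕ} (h : c < ht v) (l : List (V × ℕ)) :
    rem R ht F v l c = Finsupp.single c (vec R ht F l) := by
  cases l with
  | nil => rw [rem, freeRem_of_lt h]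
  | cons p l => rw [rem, if_pos h]

theorem rem_of_free {v : V} {l : List (V × ℕ)} (hl : Free R ht v l) (c : ℕ) :
    rem R ht F v l c = freeRem R ht F v c l := by
  cases l with
  | nil => rw [rem]
  | cons p l =>
    rw [rem]
    split_ifs with h h'
    · rw [freeRem_of_lt h]
    · exact absurd h' hl
    · rfl

theorem remLin_single_vec (v : V) (c : ℕ) {l : List (V × ℕ)} (hl : Valid R ht l) :
    remLin R ht F v (Finsupp.single c (vec R ht F l)) = rem R ht F v l c := by
  simp [remLin, vec, hl]

theorem remLin_of_lt (v : V) (z : WordPoly R ht F) (hz : ∀ c, ht v ≤ c → z c = 0) :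
    remLin R ht F v z = z := by
  have key : ∀ c, c < ht v → ((wordBasis R ht F).constr F fun b => rem R ht F v b.1 c) = Finsupp.lsingle c := by
    intro c hc
    refine (wordBasis R ht F).ext fun b => ?_
    rw [Module.Basis.constr_basis, rem_of_lt hc, vec_word, Finsupp.lsingle_apply]
  rw [remLin, Finsupp.lsum_apply]
  conv_rhs => rw [← Finsupp.sum_single z]
  refine Finsupp.sum_congr fun c hc => ?_
  have hc' : c < ht v := by
    by_contra h
    exact Finsupp.mem_support_iff.1 hc (hz c (by omega))
  rw [key c hc', Finsupp.lsingle_apply]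

theorem valid_cons {v : V} {i : ℕ} {l : List (V × ℕ)} (hi : i ∈ Icc 1 (ht v))
    (hf : Free R ht v l) (hl : Valid R ht l) : Valid R ht ((v, i) :: l) :=
  ⟨Finset.mem_Icc.1 hi, hf, hl⟩

/-- One term of the relation is by definition reduced to minus the remainders of the others: the
leading term if `x = v`, the term with `i = |x| - |v|` if `x` lies above `v`. Hence everything
cancels. -/
theorem remLin_gen (hirr : ∀ v, ¬ R v v) (hlt : ∀ v w, R v w → ht w < ht v)
    {v x : V} (hx : x = v ∨ R x v) (c : ℕ) {l : List (V × ℕ)}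
    (hf : Free R ht x l) (hl : Valid R ht l) : remLin R ht F v (gen R ht F x c l) = 0 := by
  rw [gen, map_add, map_sum, remLin_single_vec v _ hl]
  rw [Finset.sum_congr rfl fun i hi => remLin_single_vec v _ (valid_cons hi hf hl)]
  rcases hx with rfl | hx
  · rw [rem_of_free hf, freeRem_of_le (by omega), neg_add_eq_zero]
    refine Finset.sum_congr rfl fun i hi => ?_
    rw [rem_of_free (show Free R ht x ((x, i) :: l) from fun h => hirr x h.1)]
  · have hxv := hlt _ _ hx
    -- This is the only index for which the letter `(x, i)` is not free for `v`.
    have hk : ht x - ht v ∈ Icc 1 (ht x) := by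
      rw [Finset.mem_Icc]
      omega
    rw [← Finset.add_sum_erase _ _ hk, rem, if_neg (by omega),
      if_pos ⟨hx, by dsimp only; omega⟩]
    have h1 : c + ht x - (ht x - ht v) + (ht x - ht v) = c + ht x := by omega
    dsimp only
    rw [h1]
    have h2 : ∀ i ∈ (Icc 1 (ht x)).erase (ht x - ht v),
        rem R ht F v ((x, i) :: l) (c + ht x - i) =
          freeRem R ht F v (c + ht x - i) ((x, i) :: l) := by
      intro i hi
      refine rem_of_free (fun h => ?_) _
      have := h.2
      dsimp only at this
      rw [Finset.mem_erase] at hi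
      omega
    rw [Finset.sum_congr rfl h2]
    abel

theorem gen_mem {v x : V} (hx : x = v ∨ R x v) (c : ℕ) {l : List (V × ℕ)}
    (hf : Free R ht x l) (hl : Valid R ht l) : gen R ht F x c l ∈ multiples R ht F v :=
  Submodule.subset_span ⟨x, c, l, hx, hf, hl, rfl⟩

theorem remLin_eq_zero (hirr : ∀ v, ¬ R v v) (hlt : ∀ v w, R v w → ht w < ht v)
    {v : V} {z : WordPoly R ht F} (hz : z ∈ multiples R ht F v) : remLin R ht F v z = 0 := by
  induction hz using Submodule.span_induction with
  | mem z hz =>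
    obtain ⟨x, c, l, hx, hf, hl, rfl⟩ := hz
    exact remLin_gen hirr hlt hx c hf hl
  | zero => exact map_zero _
  | add y z _ _ hy hz => rw [map_add, hy, hz, add_zero]
  | smul a z _ hz => rw [map_smul, hz, smul_zero]

/-- Each reduction step subtracts one shifted relation of `v` and lowers the exponent. By
irreflexivity a word ending in `(v, i)` is again free for `v`, so the step can be repeated. -/
theorem single_sub_freeRem_mem (hirr : ∀ v, ¬ R v v) (v : V) (c : ℕ) :
    ∀ {l : List (V × ℕ)}, Valid R ht l → Free R ht v l →
      Finsupp.single c (vec R ht F l) - freeRem R ht F v c l ∈ multiples R ht F v := by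
  induction c using Nat.strong_induction_on with
  | _ c ih =>
    intro l hl hf
    by_cases h : c < ht v
    · rw [freeRem_of_lt h, sub_self]
      exact zero_mem _
    · have hg := gen_mem (F := F) (Or.inl rfl) (c - ht v) hf hl
      have hs : ∑ i ∈ Icc 1 (ht v), (Finsupp.single (c - i) (vec R ht F ((v, i) :: l)) -
          freeRem R ht F v (c - i) ((v, i) :: l)) ∈ multiples R ht F v := by
        refine Submodule.sum_mem _ fun i hi => ih _ ?_ (valid_cons hi hf hl) fun h => hirr _ h.1
        rw [Finset.mem_Icc] at hi
        omega
      rw [gen, Nat.sub_add_cancel (not_lt.1 h)] at hg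
      rw [freeRem_of_le (not_lt.1 h)]
      convert Submodule.sub_mem _ hg hs using 1
      rw [Finset.sum_sub_distrib]
      abel

/-- The induction is on the word, for all exponents at once: reducing a forbidden ending raises the
exponent of the shorter word, while the other new words are free for `v` and fall under the previous
lemma. -/
theorem single_sub_rem_mem (hirr : ∀ v, ¬ R v v) (v : V) {l : List (V × ℕ)} (hl : Valid R ht l)
    (c : ℕ) : Finsupp.single c (vec R ht F l) - rem R ht F v l c ∈ multiples R ht F v := by
  induction l generalizing c with
  | nil => exact single_sub_freeRem_mem hirr v c hl trivial
  | cons p l ih =>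
    obtain ⟨x, k⟩ := p
    rw [rem]
    split_ifs with h h'
    · rw [sub_self]
      exact zero_mem _
    · obtain ⟨hk, hf, hl'⟩ := hl
      dsimp only at h' hk hf
      have hg := gen_mem (F := F) (Or.inr h'.1) (c - ht v) hf hl'
      have hc : c - ht v + ht x = c + k := by omega
      have hs : ∑ i ∈ (Icc 1 (ht x)).erase k,
          (Finsupp.single (c + k - i) (vec R ht F ((x, i) :: l)) -
          freeRem R ht F v (c + k - i) ((x, i) :: l)) ∈ multiples R ht F v := by
        refine Submodule.sum_mem _ fun i hi => single_sub_freeRem_mem hirr v _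
          (valid_cons (Finset.mem_of_mem_erase hi) hf hl') fun h => ?_
        have := h.2
        dsimp only at this
        rw [Finset.mem_erase] at hi
        omega
      rw [gen, hc, ← Finset.add_sum_erase _ _ (Finset.mem_Icc.2 hk), Nat.add_sub_cancel] at hg
      convert Submodule.sub_mem _ (Submodule.sub_mem _ hg hs) (ih hl' (c + k)) using 1
      rw [Finset.sum_sub_distrib]
      abel
    · exact single_sub_freeRem_mem hirr v c hl h'

theorem sub_remLin_mem (hirr : ∀ v, ¬ R v v) (v : V) (z : WordPoly R ht F) :
    z - remLin R ht F v z ∈ multiples R ht F v := by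
  have key : ((multiples R ht F v).mkQ ∘ₗ (LinearMap.id - remLin R ht F v)) = 0 := by
    refine Finsupp.lhom_ext' fun c => (wordBasis R ht F).ext fun b => ?_
    have := single_sub_rem_mem (F := F) hirr v b.2 c
    rw [← remLin_single_vec v c b.2, vec_word] at this
    exact (Submodule.Quotient.mk_eq_zero _).2 this
  exact (Submodule.Quotient.mk_eq_zero _).1 (LinearMap.congr_fun key z)

/-- Including the relations of all vertices above `v` in `multiples v` makes this a matter of
transitivity; it is the formal counterpart of p_v being a multiple of p_w. -/
theorem multiples_mono (htr : ∀ u v w, R u v → R v w → R u w) {v w : V} (h : R v w) :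
    multiples R ht F v ≤ multiples R ht F w := by
  refine Submodule.span_mono ?_
  rintro z ⟨x, c, l, hx, hf, hl, rfl⟩
  refine ⟨x, c, l, Or.inr ?_, hf, hl, rfl⟩
  rcases hx with rfl | hx
  exacts [h, htr _ _ _ hx h]

theorem freeRem_apply_of_le {v : V} (c : ℕ) : ∀ (l : List (V × ℕ)) {d : ℕ}, ht v ≤ d →
    freeRem R ht F v c l d = 0 := by
  induction c using Nat.strong_induction_on with
  | _ c ih =>
    intro l d hd
    by_cases h : c < ht v
    · rw [freeRem_of_lt h, Finsupp.single_eq_of_ne (by omega)]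
    · rw [freeRem_of_le (not_lt.1 h), Finsupp.neg_apply, Finsupp.finsetSum_apply,
        Finset.sum_eq_zero, neg_zero]
      intro i hi
      rw [Finset.mem_Icc] at hi
      exact ih _ (by omega) _ hd

theorem rem_apply_of_le {v : V} (l : List (V × ℕ)) (c : ℕ) {d : ℕ} (hd : ht v ≤ d) :
    rem R ht F v l c d = 0 := by
  induction l generalizing c with
  | nil => exact freeRem_apply_of_le c [] hd
  | cons p l ih =>
    rw [rem]
    split_ifs with h h'
    · rw [Finsupp.single_eq_of_ne (by omega)]
    · rw [Finsupp.neg_apply, Finsupp.add_apply, ih, Finsupp.finsetSum_apply,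
        Finset.sum_eq_zero, add_zero, neg_zero]
      exact fun i _ => freeRem_apply_of_le _ _ hd
    · exact freeRem_apply_of_le _ _ hd

theorem remLin_apply_of_le {v : V} (z : WordPoly R ht F) {d : ℕ} (hd : ht v ≤ d) :
    remLin R ht F v z d = 0 := by
  have key : Finsupp.lapply d ∘ₗ remLin R ht F v = 0 := by
    refine Finsupp.lhom_ext' fun c => (wordBasis R ht F).ext fun b => ?_
    have := rem_apply_of_le (R := R) (F := F) b.1 c hd
    rw [← remLin_single_vec v c b.2, vec_word] at this
    simpa using this
  exact LinearMap.congr_fun key z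

end LayeredWords

end

noncomputable section

/-! ### The polynomials of operators attached to the vertices -/

namespace LayeredWords

open Finset Polynomial

/-! ### Operator polynomials acting on polynomials with vector coefficients -/

section Action

variable (F : Type*) [Field F] (N : Type*) [AddCommGroup N] [Module F N]

/-- Endomorphisms of `N` acting coefficientwise on `ℕ →₀ N`. -/
def coeffwise : Module.End F N →+* Module.End F (ℕ →₀ N) where
  toFun f := Finsupp.mapRange.linearMap f
  map_one' := by ext; simp
  map_mul' f g := by ext; simp
  map_zero' := by ext; simp
  map_add' f g := by ext; simp

/-- Multiplication by the variable on `ℕ →₀ N`. -/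
def shift : Module.End F (ℕ →₀ N) := Finsupp.lmapDomain N F (· + 1)

/-- The action of polynomials with coefficients in `End N` on polynomials with coefficients
in `N`. -/
def polyAct : (Module.End F N)[X] →+* Module.End F (ℕ →₀ N) :=
  eval₂RingHom' (coeffwise F N) (shift F N) fun f => by
    ext c m : 2
    simp [coeffwise, shift, Finsupp.mapDomain_single]

variable {F N}

theorem polyAct_X_pow_single (c d : ℕ) (m : N) :
    polyAct F N (X ^ c) (Finsupp.single d m) = Finsupp.single (d + c) m := by
  induction c with
  | zero => simp
  | succ c ih =>
    rw [pow_succ', map_mul, Module.End.mul_apply, ih]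
    simp [polyAct, shift, Finsupp.mapDomain_single, eval₂RingHom', add_assoc]

theorem polyAct_C_single (f : Module.End F N) (d : ℕ) (m : N) :
    polyAct F N (C f) (Finsupp.single d m) = Finsupp.single d (f m) := by
  simp [polyAct, coeffwise, eval₂RingHom']

/-- An operator polynomial is determined by its values on constants, so its vanishing can be tested
there. -/
theorem polyAct_single_zero_apply (p : (Module.End F N)[X]) (m : N) (j : ℕ) :
    polyAct F N p (Finsupp.single 0 m) j = p.coeff j m := by
  induction p using Polynomial.induction_on' with
  | add p q hp hq => simp [hp, hq]
  | monomial n f =>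
    rw [← C_mul_X_pow_eq_monomial, map_mul, Module.End.mul_apply, polyAct_X_pow_single,
      polyAct_C_single, coeff_C_mul_X_pow, zero_add, Finsupp.single_apply]
    by_cases h : n = j
    · rw [if_pos h, if_pos h.symm]
    · rw [if_neg h, if_neg (Ne.symm h), LinearMap.zero_apply]

theorem polyAct_single (p : (Module.End F N)[X]) (c : ℕ) (m : N) :
    polyAct F N p (Finsupp.single c m) =
      polyAct F N (X ^ c) (polyAct F N p (Finsupp.single 0 m)) := by
  rw [← Module.End.mul_apply, ← map_mul, X_pow_mul, map_mul, Module.End.mul_apply,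
    polyAct_X_pow_single, zero_add]

end Action

/-! ### The monic polynomials of the vertices and their divisibility -/

variable {V : Type*} (R : V → V → Prop) (ht : V → ℕ) (F : Type*) [Field F]

/-- The `j`-th coefficient of the remainder of `m t ^ |v|`, as a function of `m`. -/
def remCoeff (v : V) (j : ℕ) : Module.End F (WordSpace R ht F) :=
  Finsupp.lapply j ∘ₗ remLin R ht F v ∘ₗ Finsupp.lsingle (ht v)

/-- The monic polynomial of degree `|v|` whose right multiples are `multiples v`. -/
def vertexPoly (v : V) : (Module.End F (WordSpace R ht F))[X] :=
  X ^ ht v - ∑ j ∈ range (ht v), C (remCoeff R ht F v j) * X ^ j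

variable {R ht F}

theorem coeff_vertexPoly (v : V) (j : ℕ) :
    (vertexPoly R ht F v).coeff j =
      (if j = ht v then 1 else 0) - if j < ht v then remCoeff R ht F v j else 0 := by
  simp [vertexPoly, coeff_X_pow, coeff_C_mul, finsetSum_coeff]

theorem monic_vertexPoly (v : V) : (vertexPoly R ht F v).Monic := by
  refine monic_X_pow_sub ?_
  refine (degree_lt_iff_coeff_zero _ _).2 fun j hj => ?_
  rw [finsetSum_coeff]
  refine Finset.sum_eq_zero fun i hi => ?_
  rw [coeff_C_mul_X_pow, if_neg]
  rw [Finset.mem_range] at hi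
  omega

instance : Nontrivial (WordSpace R ht F) :=
  have : Nonempty (Word R ht) := ⟨⟨[], trivial⟩⟩
  (wordBasis R ht F).repr.toEquiv.nontrivial

theorem natDegree_vertexPoly (v : V) : (vertexPoly R ht F v).natDegree = ht v := by
  refine natDegree_eq_of_le_of_coeff_ne_zero ?_ ?_
  · refine natDegree_le_iff_coeff_eq_zero.2 fun j hj => ?_
    rw [coeff_vertexPoly, if_neg (by omega), if_neg (by omega), sub_zero]
  · rw [coeff_vertexPoly, if_pos rfl, if_neg (by omega), sub_zero]
    exact one_ne_zero

theorem polyAct_vertexPoly_single_zero (v : V) (m : WordSpace R ht F) :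
    polyAct F _ (vertexPoly R ht F v) (Finsupp.single 0 m) =
      Finsupp.single (ht v) m - remLin R ht F v (Finsupp.single (ht v) m) := by
  ext j
  rw [polyAct_single_zero_apply, coeff_vertexPoly, Finsupp.sub_apply, LinearMap.sub_apply,
    Finsupp.single_apply]
  congr 1
  · by_cases h : j = ht v
    · rw [if_pos h, if_pos h.symm, Module.End.one_apply]
    · rw [if_neg h, if_neg (Ne.symm h), LinearMap.zero_apply]
  · split_ifs with h
    · rfl
    · rw [remLin_apply_of_le _ (not_lt.1 h), LinearMap.zero_apply]

theorem polyAct_X_pow_mem {v : V} (c : ℕ) {z : WordPoly R ht F} (hz : z ∈ multiples R ht F v) :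
    polyAct F _ (X ^ c) z ∈ multiples R ht F v := by
  induction hz using Submodule.span_induction with
  | mem z hz =>
    obtain ⟨x, d, l, hx, hf, hl, rfl⟩ := hz
    convert gen_mem hx (d + c) hf hl using 1
    rw [gen, gen, map_add, map_sum, polyAct_X_pow_single, add_right_comm]
    congr 1
    refine Finset.sum_congr rfl fun i hi => ?_
    rw [polyAct_X_pow_single]
    rw [Finset.mem_Icc] at hi
    congr 1
    omega
  | zero => rw [map_zero]; exact zero_mem _
  | add y z _ _ hy hz => rw [map_add]; exact add_mem hy hz
  | smul a z _ hz => rw [map_smul]; exact Submodule.smul_mem _ _ hz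

theorem polyAct_vertexPoly_mem (hirr : ∀ v, ¬ R v v) (v : V) (z : WordPoly R ht F) :
    polyAct F _ (vertexPoly R ht F v) z ∈ multiples R ht F v := by
  induction z using Finsupp.induction_linear with
  | zero => rw [map_zero]; exact zero_mem _
  | add y z hy hz => rw [map_add]; exact add_mem hy hz
  | single c m =>
    rw [polyAct_single, polyAct_vertexPoly_single_zero]
    exact polyAct_X_pow_mem c (sub_remLin_mem hirr v _)

/-- Divide P_v by P_w. Applied to a constant, the remainder lies in `multiples w` because P_v and
P_w both take values there; having degree less than |w|, it is its own remainder under `remLin`,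
hence zero. -/
theorem vertexPoly_dvd (hirr : ∀ v, ¬ R v v) (htr : ∀ u v w, R u v → R v w → R u w)
    (hlt : ∀ v w, R v w → ht w < ht v) {v w : V} (h : R v w) :
    vertexPoly R ht F w ∣ vertexPoly R ht F v := by
  set q := vertexPoly R ht F v /ₘ vertexPoly R ht F w with hq
  set r := vertexPoly R ht F v %ₘ vertexPoly R ht F w with hr
  have hdiv : r + vertexPoly R ht F w * q = vertexPoly R ht F v := modByMonic_add_div _ _
  have hdeg : r.degree < ht w := by
    have := degree_modByMonic_lt (vertexPoly R ht F v) (monic_vertexPoly (F := F) (R := R) w)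
    rwa [degree_eq_natDegree (monic_vertexPoly w).ne_zero, natDegree_vertexPoly] at this
  have hr0 : r = 0 := by
    ext1 j
    refine LinearMap.ext fun m => ?_
    have hmem : polyAct F _ r (Finsupp.single 0 m) ∈ multiples R ht F w := by
      rw [eq_sub_of_add_eq hdiv, map_sub, map_mul, LinearMap.sub_apply, Module.End.mul_apply]
      exact sub_mem (multiples_mono htr h (polyAct_vertexPoly_mem hirr v _))
        (polyAct_vertexPoly_mem hirr w _)
    have h0 := remLin_eq_zero hirr hlt hmem
    rw [remLin_of_lt] at h0
    · rw [← polyAct_single_zero_apply, h0, coeff_zero]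
      rfl
    · intro c hc
      rw [polyAct_single_zero_apply, (degree_lt_iff_coeff_zero _ _).1 hdeg c hc,
        LinearMap.zero_apply]
  exact ⟨q, by rw [← hdiv, hr0, zero_add]⟩

/-- On a word free for `v` the division of degree |v| stops after one step, since all new exponents
are below |v|. So the coefficients of P_v append letters. -/
theorem coeff_vertexPoly_vec {v : V} {k : ℕ} (hk : k ∈ Icc 1 (ht v))
    {l : List (V × ℕ)} (hf : Free R ht v l) (hl : Valid R ht l) :
    (vertexPoly R ht F v).coeff (ht v - k) (vec R ht F l) = vec R ht F ((v, k) :: l) := by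
  have hk' := Finset.mem_Icc.1 hk
  rw [coeff_vertexPoly, if_neg (by omega), if_pos (by omega), zero_sub, LinearMap.neg_apply,
    remCoeff, LinearMap.comp_apply, LinearMap.comp_apply, Finsupp.lsingle_apply,
    remLin_single_vec v _ hl, rem_of_free hf, freeRem_of_le le_rfl, map_neg, neg_neg, map_sum,
    Finset.sum_eq_single_of_mem k hk]
  · rw [freeRem_of_lt (by omega), Finsupp.lapply_apply, Finsupp.single_eq_same]
  · intro i hi hik
    rw [Finset.mem_Icc] at hi
    rw [freeRem_of_lt (by omega), Finsupp.lapply_apply, Finsupp.single_eq_of_ne (by omega)]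

end LayeredWords

end

noncomputable section

/-! ### The action of `A(Γ)` on the space of words -/

namespace GenLayeredGraph

open Finset Polynomial LayeredWords MulOpposite

variable {V E : Type*} (Γ : GenLayeredGraph V E) (F : Type*) [Field F]

variable {Γ} in
theorem IsPath.rank_lt {v w : V} {π : List E} (h : Γ.IsPath v w π) : Γ.rank w < Γ.rank v := by
  induction h with
  | single e => exact Γ.rank_lt e
  | cons e _ ih => exact ih.trans (Γ.rank_lt e)

variable {Γ} in
theorem IsPath.append {u v w : V} {π π' : List E} (h : Γ.IsPath u v π) (h' : Γ.IsPath v w π') :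
    Γ.IsPath u w (π ++ π') := by
  induction h with
  | single e => exact .cons e h'
  | cons e _ ih => exact .cons e (ih h')

variable {Γ} in
theorem Above.trans {u v w : V} (h : Γ.Above u v) (h' : Γ.Above v w) : Γ.Above u w := by
  obtain ⟨π, hπ⟩ := h
  obtain ⟨π', hπ'⟩ := h'
  exact ⟨_, hπ.append hπ'⟩

variable {Γ} in
theorem Above.rank_lt {v w : V} (h : Γ.Above v w) : Γ.rank w < Γ.rank v :=
  h.choose_spec.rank_lt

theorem above_edge (e : E) : Γ.Above (Γ.tail e) (Γ.head e) := ⟨_, .single e⟩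

variable {Γ} in
/-- Every vertex other than the unique minimal vertex lies above it. -/
theorem eq_or_above {m : V} (hm : ∀ v, Γ.IsMinimal v → v = m) (v : V) :
    v = m ∨ Γ.Above v m := by
  induction hn : Γ.rank v using Nat.strong_induction_on generalizing v with
  | _ n ih =>
    by_cases h : Γ.IsMinimal v
    · exact .inl (hm v h)
    · obtain ⟨w, hw⟩ := not_forall_not.1 h
      right
      rcases ih _ (hn ▸ hw.rank_lt) w rfl with rfl | h'
      exacts [hw, hw.trans h']

/-! #### Generating polynomials without signs -/

/-- The polynomial `∑ a_j(e) t^j`. -/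
def edgeGen (e : E) : (FreeAlgebra F Γ.ESharp)[X] :=
  ∑ j ∈ range (Γ.len e + 1), C (Γ.a F e j) * X ^ j

/-- The polynomial `∑ e(π, j) t^j`. -/
def pathGen (π : List E) : (FreeAlgebra F Γ.ESharp)[X] :=
  (π.map (Γ.edgeGen F)).prod

@[simp]
theorem pathGen_cons (e : E) (π : List E) :
    Γ.pathGen F (e :: π) = Γ.edgeGen F e * Γ.pathGen F π := by
  simp [pathGen]

theorem pathGen_append (π π' : List E) :
    Γ.pathGen F (π ++ π') = Γ.pathGen F π * Γ.pathGen F π' := by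
  simp [pathGen]

theorem coeff_edgeGen (e : E) (j : ℕ) : (Γ.edgeGen F e).coeff j = Γ.a F e j := by
  simp only [edgeGen, finsetSum_coeff, coeff_C_mul_X_pow, Finset.sum_ite_eq, Finset.mem_range]
  split_ifs with h
  · rfl
  · rw [a_of_lt Γ F e (by omega)]

/-- Substituting `-t` for `t` removes every sign, because `(-1) ^ j` is multiplicative in the
degree. -/
theorem coeff_pathGen (π : List E) (j : ℕ) : (Γ.pathGen F π).coeff j = Γ.pathCoeff F π j := by
  induction π generalizing j with
  | nil =>
    rw [pathCoeff, pathGen, pathPoly]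
    by_cases h : j = 0 <;> simp [h, coeff_one]
  | cons e π ih =>
    rw [pathGen_cons, coeff_mul, pathCoeff, pathPoly, List.map_cons, List.prod_cons, coeff_mul,
      Finset.mul_sum]
    refine Finset.sum_congr rfl fun p hp => ?_
    rw [ih, coeff_edgeGen, coeff_edgePoly, pathCoeff, ← pathPoly,
      ← HasAntidiagonal.mem_antidiagonal.1 hp, pow_add, mul_assoc, mul_assoc,
      ← mul_assoc ((-1) ^ p.2) ((-1) ^ p.1), ← pow_add, add_comm p.2, pow_add, mul_assoc,
      ← mul_assoc ((-1) ^ p.1) ((-1) ^ p.1), ← pow_add, Even.neg_one_pow ⟨_, rfl⟩, one_mul,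
      ← mul_assoc, ← ((Commute.neg_one_left (Γ.a F e p.1)).pow_left p.2).eq, mul_assoc]

theorem natDegree_edgeGen_le (e : E) : (Γ.edgeGen F e).natDegree ≤ Γ.len e := by
  refine natDegree_le_iff_coeff_eq_zero.2 fun j hj => ?_
  rw [coeff_edgeGen, a_of_lt Γ F e hj]

theorem coeff_zero_pathGen (π : List E) : (Γ.pathGen F π).coeff 0 = 1 := by
  induction π with
  | nil => simp [pathGen]
  | cons e π ih => rw [pathGen_cons, mul_coeff_zero, ih, coeff_edgeGen, a, if_pos rfl, one_mul]

variable {Γ} in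
theorem IsPath.natDegree_pathGen_le {v w : V} {π : List E} (h : Γ.IsPath v w π) :
    (Γ.pathGen F π).natDegree ≤ Γ.rank v - Γ.rank w := by
  induction h with
  | single e => simpa [pathGen, len] using Γ.natDegree_edgeGen_le F e
  | @cons e w π h ih =>
    rw [pathGen_cons]
    refine (natDegree_mul_le_of_le (Γ.natDegree_edgeGen_le F e) ih).trans ?_
    have := h.rank_lt
    have := Γ.rank_lt e
    rw [len]
    omega

-- The relations cover degrees 1 to |v| - |w|; the constant terms are 1 and higher coefficients
-- vanish for degree reasons.
variable {Γ} in
theorem IsPath.map_pathGen_eq {v w : V} {π π' : List E} (h : Γ.IsPath v w π)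
    (h' : Γ.IsPath v w π') :
    (Γ.pathGen F π).map (Γ.toA F : _ →+* Γ.A F) = (Γ.pathGen F π').map (Γ.toA F : _ →+* Γ.A F) := by
  ext j
  rw [coeff_map, coeff_map]
  by_cases hj : 1 ≤ j
  · by_cases hj' : j ≤ Γ.rank v - Γ.rank w
    · rw [coeff_pathGen, coeff_pathGen]
      exact RingQuot.mkAlgHom_rel F (Rel.mk h h' j hj hj')
    · rw [coeff_eq_zero_of_natDegree_lt ((h.natDegree_pathGen_le F).trans_lt (not_le.1 hj')),
        coeff_eq_zero_of_natDegree_lt ((h'.natDegree_pathGen_le F).trans_lt (not_le.1 hj'))]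
  · obtain rfl : j = 0 := by omega
    rw [coeff_zero_pathGen, coeff_zero_pathGen]

/-! #### The representation -/

/-- The rank of a vertex relative to the vertex `m`. -/
def height (m v : V) : ℕ := Γ.rank v - Γ.rank m

/-- The space of words in the letters `(v, k)`, `1 ≤ k ≤ |v| - |m|`, without forbidden pairs. -/
abbrev Words (m : V) : Type _ := WordSpace Γ.Above (Γ.height m) F

/-- The polynomial of operators that describes the action of an edge. -/
def edgeOp (m : V) (e : E) : (Module.End F (Γ.Words F m))[X] :=
  vertexPoly Γ.Above (Γ.height m) F (Γ.tail e) /ₘ vertexPoly Γ.Above (Γ.height m) F (Γ.head e)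

/-- The right action of the free algebra on the space of words. -/
def freeAct (m : V) : FreeAlgebra F Γ.ESharp →ₐ[F] (Module.End F (Γ.Words F m))ᵐᵒᵖ :=
  FreeAlgebra.lift F fun p => op ((Γ.edgeOp F m p.1.1).coeff (Γ.len p.1.1 - p.1.2))

variable {Γ} {m : V}

theorem rank_eq_height_add (hm : ∀ v, v = m ∨ Γ.Above v m) (v : V) :
    Γ.rank v = Γ.height m v + Γ.rank m := by
  rw [height]
  rcases hm v with rfl | h
  · omega
  · have := h.rank_lt
    omega

theorem height_lt (hm : ∀ v, v = m ∨ Γ.Above v m) (v w : V) (h : Γ.Above v w) :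
    Γ.height m w < Γ.height m v := by
  have := h.rank_lt
  rw [rank_eq_height_add hm v, rank_eq_height_add hm w] at this
  omega

theorem Above.irrefl (v : V) : ¬ Γ.Above v v := fun h => h.rank_lt.false

theorem above_trans (u v w : V) : Γ.Above u v → Γ.Above v w → Γ.Above u w := Above.trans

theorem mul_edgeOp (hm : ∀ v, v = m ∨ Γ.Above v m) (e : E) :
    vertexPoly Γ.Above (Γ.height m) F (Γ.head e) * Γ.edgeOp F m e =
      vertexPoly Γ.Above (Γ.height m) F (Γ.tail e) := by
  obtain ⟨q, hq⟩ := vertexPoly_dvd (F := F) Above.irrefl above_trans (height_lt hm) (Γ.above_edge e)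
  rw [edgeOp, hq, mul_divByMonic_cancel_left _ (monic_vertexPoly _)]

theorem monic_edgeOp (hm : ∀ v, v = m ∨ Γ.Above v m) (e : E) : (Γ.edgeOp F m e).Monic :=
  (monic_vertexPoly (F := F) (Γ.head e)).of_mul_monic_left (by
    rw [mul_edgeOp F hm]
    exact monic_vertexPoly _)

theorem natDegree_edgeOp (hm : ∀ v, v = m ∨ Γ.Above v m) (e : E) :
    (Γ.edgeOp F m e).natDegree = Γ.len e := by
  rw [edgeOp, natDegree_divByMonic _ (monic_vertexPoly _), natDegree_vertexPoly,
    natDegree_vertexPoly, len, rank_eq_height_add hm (Γ.tail e), rank_eq_height_add hm (Γ.head e)]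
  omega

theorem freeAct_a (hm : ∀ v, v = m ∨ Γ.Above v m) (e : E) (j : ℕ) :
    Γ.freeAct F m (Γ.a F e j) = op ((reflect (Γ.len e) (Γ.edgeOp F m e)).coeff j) := by
  rw [coeff_reflect]
  by_cases hj : j ≤ Γ.len e
  · rw [revAt_le hj]
    by_cases h0 : j = 0
    · rw [a, if_pos h0, h0, map_one, Nat.sub_zero, ← natDegree_edgeOp F hm e,
        (monic_edgeOp F hm e).coeff_natDegree, op_one]
    · rw [a, if_neg h0, dif_pos ⟨by omega, hj⟩, freeAct, FreeAlgebra.lift_ι_apply]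
  · rw [revAt_eq_self_of_lt (not_le.1 hj), a_of_lt Γ F e (not_le.1 hj), map_zero,
      coeff_eq_zero_of_natDegree_lt (by rw [natDegree_edgeOp F hm]; omega), op_zero]

theorem map_edgeGen (hm : ∀ v, v = m ∨ Γ.Above v m) (e : E) :
    (Γ.edgeGen F e).map (Γ.freeAct F m : _ →+* _) =
      opRingEquiv _ (op (reflect (Γ.len e) (Γ.edgeOp F m e))) := by
  ext1 j
  rw [coeff_map, coeff_opRingEquiv, coeff_edgeGen, unop_op]
  exact freeAct_a F hm e j

/-- The quotients along the edges telescope. They multiply in reverse order, which is why the action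
takes values in the opposite ring; reflection matches degree `j` with the complementary degree. -/
theorem IsPath.exists_map_pathGen (hm : ∀ v, v = m ∨ Γ.Above v m) {v w : V} {π : List E}
    (h : Γ.IsPath v w π) : ∃ q : (Module.End F (Γ.Words F m))[X],
      q.natDegree ≤ Γ.rank v - Γ.rank w ∧
      vertexPoly Γ.Above (Γ.height m) F w * q = vertexPoly Γ.Above (Γ.height m) F v ∧
      (Γ.pathGen F π).map (Γ.freeAct F m : _ →+* _) =
        opRingEquiv _ (op (reflect (Γ.rank v - Γ.rank w) q)) := by
  induction h with
  | single e =>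
    refine ⟨Γ.edgeOp F m e, (natDegree_edgeOp F hm e).le, mul_edgeOp F hm e, ?_⟩
    rw [pathGen_cons, pathGen, List.map_nil, List.prod_nil, mul_one, map_edgeGen F hm, len]
  | @cons e w π h ih =>
    obtain ⟨q, hdeg, hq, hmap⟩ := ih
    have hlen : Γ.rank (Γ.tail e) - Γ.rank w = (Γ.rank (Γ.head e) - Γ.rank w) + Γ.len e := by
      have := h.rank_lt
      have := Γ.rank_lt e
      rw [len]
      omega
    refine ⟨q * Γ.edgeOp F m e, ?_, ?_, ?_⟩
    · rw [hlen]
      exact natDegree_mul_le_of_le hdeg (natDegree_edgeOp F hm e).le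
    · rw [← mul_assoc, hq, mul_edgeOp F hm]
    · rw [pathGen_cons, Polynomial.map_mul, hmap, map_edgeGen F hm, ← map_mul, ← op_mul, hlen,
        reflect_mul _ _ hdeg (natDegree_edgeOp F hm e).le]

/-- The equation P_w q = P_v determines q, as the monic P_w is left cancellable; hence two paths
with the same ends act alike. -/
theorem freeAct_rel (hm : ∀ v, v = m ∨ Γ.Above v m) ⦃x y : FreeAlgebra F Γ.ESharp⦄
    (h : Γ.Rel F x y) : Γ.freeAct F m x = Γ.freeAct F m y := by
  obtain ⟨h₁, h₂, j, hj, hjl⟩ := h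
  obtain ⟨q₁, -, hq₁, hm₁⟩ := h₁.exists_map_pathGen F hm
  obtain ⟨q₂, -, hq₂, hm₂⟩ := h₂.exists_map_pathGen F hm
  obtain rfl : q₁ = q₂ := (monic_vertexPoly (F := F) _).isRegular.left (hq₁.trans hq₂.symm)
  have := congrArg (fun p => p.coeff j) (hm₁.trans hm₂.symm)
  simpa [coeff_map, coeff_pathGen] using this

/-- The right action of `A(Γ)` on the space of words. -/
def act (hm : ∀ v, v = m ∨ Γ.Above v m) : Γ.A F →ₐ[F] (Module.End F (Γ.Words F m))ᵐᵒᵖ :=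
  RingQuot.liftAlgHom F ⟨Γ.freeAct F m, freeAct_rel F hm⟩

theorem act_toA (hm : ∀ v, v = m ∨ Γ.Above v m) (x : FreeAlgebra F Γ.ESharp) :
    act F hm (Γ.toA F x) = Γ.freeAct F m x :=
  RingQuot.liftAlgHom_mkAlgHom_apply ..

theorem act_pathCoeff (hm : ∀ v, v = m ∨ Γ.Above v m) {v : V} {π : List E}
    (h : Γ.IsPath v m π) {k : ℕ} (hk : k ≤ Γ.height m v) :
    act F hm (Γ.toA F (Γ.pathCoeff F π k)) =
      op ((vertexPoly Γ.Above (Γ.height m) F v).coeff (Γ.height m v - k)) := by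
  obtain ⟨q, -, hq, hmap⟩ := h.exists_map_pathGen F hm
  -- A monic polynomial of degree 0 is 1, so the quotient along a path down to `m` is P_v itself.
  have h1 : vertexPoly Γ.Above (Γ.height m) F m = 1 := by
    refine (monic_vertexPoly _).natDegree_eq_zero.1 ?_
    rw [natDegree_vertexPoly, height, Nat.sub_self]
  rw [h1, one_mul] at hq
  have := congrArg (fun p => p.coeff k) hmap
  rw [coeff_map, coeff_pathGen, coeff_opRingEquiv, unop_op, coeff_reflect, ← height, revAt_le hk,
    hq] at this
  rw [act_toA]
  exact this

/-- A choice of a path to the minimal vertex from every other vertex. -/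
def IsDescent (Γ : GenLayeredGraph V E) (m : V) (pth : V → List E) : Prop :=
  pth m = [] ∧ ∀ v, v ≠ m → Γ.IsPath v m (pth v)

variable (Γ)

/-- The element of `A(Γ)` given by a (reversed) word. -/
def wordElt (pth : V → List E) : List (V × ℕ) → Γ.A F
  | [] => 1
  | p :: l => wordElt pth l * Γ.toA F (Γ.pathCoeff F (pth p.1) p.2)

variable {Γ} {pth : V → List E}

/-- The action of an element of `A(Γ)` on the empty word. -/
def evalNil (hm : ∀ v, v = m ∨ Γ.Above v m) : Γ.A F →ₗ[F] Γ.Words F m :=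
  LinearMap.applyₗ (vec Γ.Above (Γ.height m) F []) ∘ₗ
    (opLinearEquiv F (M := Module.End F (Γ.Words F m))).symm.toLinearMap ∘ₗ (act F hm).toLinearMap

theorem evalNil_apply (hm : ∀ v, v = m ∨ Γ.Above v m) (x : Γ.A F) :
    evalNil F hm x = unop (act F hm x) (vec Γ.Above (Γ.height m) F []) := rfl

/-- Starting from the empty word, the letters are appended one at a time; validity says that each
letter meets a word free for its vertex. -/
theorem evalNil_wordElt (hm : ∀ v, v = m ∨ Γ.Above v m) (hp : Γ.IsDescent m pth)
    {l : List (V × ℕ)} (hl : Valid Γ.Above (Γ.height m) l) :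
    evalNil F hm (Γ.wordElt F pth l) = vec Γ.Above (Γ.height m) F l := by
  induction l with
  | nil => rw [evalNil_apply, wordElt, map_one]; rfl
  | cons p l ih =>
    obtain ⟨hk, hf, hl'⟩ := hl
    have hne : p.1 ≠ m := by
      intro h
      have : Γ.height m m = 0 := Nat.sub_self _
      rw [h, this] at hk
      omega
    have h := ih hl'
    rw [evalNil_apply] at h ⊢
    rw [wordElt, map_mul, unop_mul, Module.End.mul_apply, h,
      act_pathCoeff F hm (hp.2 _ hne) hk.2, unop_op,
      coeff_vertexPoly_vec (Finset.mem_Icc.2 hk) hf hl']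

end GenLayeredGraph

end

noncomputable section

/-! ### The words span `A(Γ)` -/

namespace GenLayeredGraph

open Finset Polynomial LayeredWords MulOpposite

variable {V E : Type*} {Γ : GenLayeredGraph V E} (F : Type*) [Field F] {m : V} {pth : V → List E}

/-- The polynomial `∑ e(v, k) t^k` over `A(Γ)`. -/
def vertexGen (Γ : GenLayeredGraph V E) (pth : V → List E) (v : V) : (Γ.A F)[X] :=
  (Γ.pathGen F (pth v)).map (Γ.toA F : _ →+* Γ.A F)

theorem coeff_vertexGen (v : V) (k : ℕ) :
    (Γ.vertexGen F pth v).coeff k = Γ.toA F (Γ.pathCoeff F (pth v) k) := by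
  rw [vertexGen, coeff_map, coeff_pathGen]
  rfl

theorem coeff_zero_vertexGen (v : V) : (Γ.vertexGen F pth v).coeff 0 = 1 := by
  rw [vertexGen, coeff_map, coeff_zero_pathGen, map_one]

theorem IsDescent.natDegree_vertexGen_le (hp : Γ.IsDescent m pth) (v : V) :
    (Γ.vertexGen F pth v).natDegree ≤ Γ.height m v := by
  refine natDegree_map_le.trans ?_
  by_cases h : v = m
  · rw [h, hp.1, pathGen, List.map_nil, List.prod_nil, natDegree_one]
    exact Nat.zero_le _
  · exact (hp.2 v h).natDegree_pathGen_le F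

theorem IsDescent.map_pathGen_mul (hp : Γ.IsDescent m pth) {v w : V} {π : List E}
    (h : Γ.IsPath v w π) (hv : v ≠ m) :
    (Γ.pathGen F π).map (Γ.toA F : _ →+* Γ.A F) * Γ.vertexGen F pth w = Γ.vertexGen F pth v := by
  rw [vertexGen, vertexGen, ← Polynomial.map_mul, ← pathGen_append]
  refine IsPath.map_pathGen_eq F (v := v) (w := m) ?_ (hp.2 v hv)
  by_cases hw : w = m
  · rw [hw, hp.1, List.append_nil]
    rwa [hw] at h
  · exact h.append (hp.2 w hw)

/-- The monic polynomial `∑ e(v, k) t^(|v| - k)` over `A(Γ)`. -/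
def revGen (Γ : GenLayeredGraph V E) (m : V) (pth : V → List E) (v : V) : (Γ.A F)[X] :=
  reflect (Γ.height m v) (Γ.vertexGen F pth v)

theorem coeff_revGen {v : V} {k : ℕ} (hk : k ≤ Γ.height m v) :
    (Γ.revGen F m pth v).coeff (Γ.height m v - k) = Γ.toA F (Γ.pathCoeff F (pth v) k) := by
  rw [revGen, coeff_reflect, revAt_le (Nat.sub_le _ _), Nat.sub_sub_self hk, coeff_vertexGen]

theorem IsDescent.natDegree_revGen_le (hp : Γ.IsDescent m pth) (v : V) :
    (Γ.revGen F m pth v).natDegree ≤ Γ.height m v :=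
  natDegree_reflect_le.trans (max_le le_rfl (hp.natDegree_vertexGen_le F v))

theorem coeff_height_revGen (v : V) : (Γ.revGen F m pth v).coeff (Γ.height m v) = 1 := by
  rw [revGen, coeff_reflect, revAt_le le_rfl, Nat.sub_self, coeff_zero_vertexGen]

theorem IsDescent.revGen_eq (hp : Γ.IsDescent m pth) (v : V) :
    Γ.revGen F m pth v = X ^ Γ.height m v + ∑ i ∈ Icc 1 (Γ.height m v),
      C (Γ.toA F (Γ.pathCoeff F (pth v) i)) * X ^ (Γ.height m v - i) := by
  rw [(Γ.revGen F m pth v).as_sum_range_C_mul_X_pow'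
    (Nat.lt_succ_of_le (hp.natDegree_revGen_le F v)), ← Finset.sum_range_reflect,
    Finset.sum_range_succ', Nat.succ_sub_one, Nat.sub_zero, coeff_height_revGen, map_one, one_mul,
    add_comm, Finset.range_eq_Ico, Finset.sum_Ico_add' (fun i =>
      C ((Γ.revGen F m pth v).coeff (Γ.height m v - i)) * X ^ (Γ.height m v - i)), zero_add,
    Finset.Ico_add_one_right_eq_Icc]
  congr 1
  refine Finset.sum_congr rfl fun i hi => ?_
  rw [coeff_revGen F (Finset.mem_Icc.1 hi).2]

theorem IsDescent.exists_mul_revGen (hm : ∀ v, v = m ∨ Γ.Above v m) (hp : Γ.IsDescent m pth)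
    {v w : V} (h : v = w ∨ Γ.Above v w) :
    ∃ q, Γ.revGen F m pth v = q * Γ.revGen F m pth w := by
  rcases h with rfl | ⟨π, h⟩
  · exact ⟨1, (one_mul _).symm⟩
  · have hr := h.rank_lt
    have hv := rank_eq_height_add hm v
    have hw := rank_eq_height_add hm w
    have hne : v ≠ m := by
      rintro rfl
      rw [height] at hv hw
      omega
    refine ⟨reflect (Γ.rank v - Γ.rank w) ((Γ.pathGen F π).map (Γ.toA F : _ →+* Γ.A F)), ?_⟩
    rw [revGen, revGen, ← reflect_mul _ _ (natDegree_map_le.trans (h.natDegree_pathGen_le F))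
      (hp.natDegree_vertexGen_le F w), hp.map_pathGen_mul F h hne]
    congr 1
    omega

/-- The linear map from the space of words to `A(Γ)`. -/
def ofWords (Γ : GenLayeredGraph V E) (m : V) (pth : V → List E) : Γ.Words F m →ₗ[F] Γ.A F :=
  (wordBasis Γ.Above (Γ.height m) F).constr F fun b => Γ.wordElt F pth b.1

theorem ofWords_vec {l : List (V × ℕ)} (hl : Valid Γ.Above (Γ.height m) l) :
    Γ.ofWords F m pth (vec Γ.Above (Γ.height m) F l) = Γ.wordElt F pth l := by
  rw [vec, dif_pos hl, ofWords, Module.Basis.constr_basis]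

/-- The coefficientwise extension of `ofWords` to polynomials. -/
def polyOfWords (Γ : GenLayeredGraph V E) (m : V) (pth : V → List E) :
    WordPoly Γ.Above (Γ.height m) F →ₗ[F] (Γ.A F)[X] :=
  Finsupp.lsum F fun c => (monomial c).restrictScalars F ∘ₗ Γ.ofWords F m pth

theorem polyOfWords_single (c : ℕ) (x : Γ.Words F m) :
    Γ.polyOfWords F m pth (Finsupp.single c x) = C (Γ.ofWords F m pth x) * X ^ c := by
  simp [polyOfWords, C_mul_X_pow_eq_monomial]

theorem coeff_polyOfWords (z : WordPoly Γ.Above (Γ.height m) F) (j : ℕ) :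
    (Γ.polyOfWords F m pth z).coeff j = Γ.ofWords F m pth (z j) := by
  induction z using Finsupp.induction_linear with
  | zero => simp
  | add y z hy hz => simp [hy, hz]
  | single c x =>
    rw [polyOfWords_single, coeff_C_mul_X_pow, Finsupp.single_apply]
    by_cases h : c = j
    · rw [if_pos h, if_pos h.symm]
    · rw [if_neg h, if_neg (Ne.symm h), map_zero]

theorem IsDescent.polyOfWords_gen (hp : Γ.IsDescent m pth) (v : V) (c : ℕ) {l : List (V × ℕ)}
    (hf : Free Γ.Above (Γ.height m) v l) (hl : Valid Γ.Above (Γ.height m) l) :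
    Γ.polyOfWords F m pth (gen Γ.Above (Γ.height m) F v c l) =
      X ^ c * C (Γ.wordElt F pth l) * Γ.revGen F m pth v := by
  rw [gen, map_add, map_sum, polyOfWords_single, ofWords_vec F hl, hp.revGen_eq F, mul_add,
    X_pow_mul, Finset.mul_sum, mul_assoc, ← pow_add]
  congr 1
  refine Finset.sum_congr rfl fun i hi => ?_
  rw [polyOfWords_single, ofWords_vec F (valid_cons hi hf hl), wordElt, map_mul, mul_assoc,
    mul_assoc, ← mul_assoc (X ^ c), X_pow_mul, mul_assoc, ← pow_add]
  rw [Finset.mem_Icc] at hi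
  congr 4
  omega

/-- Formal multiples become genuine ones, since in A(Γ)[t] the polynomial of a vertex above `v` is a
left multiple of that of `v`. -/
theorem IsDescent.exists_polyOfWords_eq (hm : ∀ v, v = m ∨ Γ.Above v m)
    (hp : Γ.IsDescent m pth) {v : V} {z : WordPoly Γ.Above (Γ.height m) F}
    (hz : z ∈ multiples Γ.Above (Γ.height m) F v) :
    ∃ s, Γ.polyOfWords F m pth z = s * Γ.revGen F m pth v := by
  induction hz using Submodule.span_induction with
  | mem z hz =>
    obtain ⟨x, c, l, hx, hf, hl, rfl⟩ := hz
    obtain ⟨q, hq⟩ := hp.exists_mul_revGen F hm hx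
    exact ⟨_, by rw [hp.polyOfWords_gen F x c hf hl, hq, ← mul_assoc]⟩
  | zero => exact ⟨0, by rw [map_zero, zero_mul]⟩
  | add y z _ _ hy hz =>
    obtain ⟨s, hs⟩ := hy
    obtain ⟨t, ht⟩ := hz
    exact ⟨s + t, by rw [map_add, hs, ht, add_mul]⟩
  | smul a z _ hz =>
    obtain ⟨s, hs⟩ := hz
    exact ⟨a • s, by rw [map_smul, hs, smul_mul_assoc]⟩

/-- With `p` monic of degree `n`, degrees add in `s * p`; a product of degree at most `n` therefore
forces `s` to be constant. -/
theorem eq_C_of_coeff_mul {S : Type*} [Semiring S] {s p : S[X]} {n : ℕ} {b : S}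
    (hp : p.natDegree ≤ n) (hpn : p.coeff n = 1) (hb : (s * p).coeff n = b)
    (h0 : ∀ j, n < j → (s * p).coeff j = 0) : s = C b := by
  nontriviality S
  have hmonic := monic_of_natDegree_le_of_coeff_eq_one n hp hpn
  have hdeg : p.natDegree = n :=
    natDegree_eq_of_le_of_coeff_ne_zero hp (by rw [hpn]; exact one_ne_zero)
  have hs : s.natDegree = 0 := by
    by_contra hne
    have hs0 : s ≠ 0 := fun h => hne (by rw [h, natDegree_zero])
    have h := natDegree_le_iff_coeff_eq_zero.2 h0
    rw [natDegree_mul' (by rwa [hmonic.leadingCoeff, mul_one, leadingCoeff_ne_zero]), hdeg] at h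
    omega
  rw [eq_C_of_natDegree_eq_zero hs, coeff_C_mul, hpn, mul_one] at hb
  rw [eq_C_of_natDegree_eq_zero hs, hb]

/-- Subtracting from l t^|v| its remainder gives a formal multiple with leading term l t^|v|. Its
image s p_v in A(Γ)[t] thus has s = l, and its coefficients l · e(v,k) are images of vectors in the
word space. -/
theorem IsDescent.wordElt_mul_mem_range (hm : ∀ v, v = m ∨ Γ.Above v m)
    (hp : Γ.IsDescent m pth) {l : List (V × ℕ)} (hl : Valid Γ.Above (Γ.height m) l) (v : V)
    (k : ℕ) : Γ.wordElt F pth l * Γ.toA F (Γ.pathCoeff F (pth v) k) ∈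
      LinearMap.range (Γ.ofWords F m pth) := by
  by_cases hk : k ≤ Γ.height m v
  swap
  · rw [← coeff_vertexGen, coeff_eq_zero_of_natDegree_lt
      ((hp.natDegree_vertexGen_le F v).trans_lt (not_le.1 hk)), mul_zero]
    exact zero_mem _
  set z := Finsupp.single (Γ.height m v) (vec Γ.Above (Γ.height m) F l) -
    rem Γ.Above (Γ.height m) F v l (Γ.height m v) with hz
  obtain ⟨s, hs⟩ := hp.exists_polyOfWords_eq F hm
    (single_sub_rem_mem (F := F) Above.irrefl v hl (Γ.height m v))
  rw [← hz] at hs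
  have hs' : s = C (Γ.wordElt F pth l) := by
    refine eq_C_of_coeff_mul (hp.natDegree_revGen_le F v) (coeff_height_revGen F v) ?_
      fun j hj => ?_
    · rw [← hs, coeff_polyOfWords, hz, Finsupp.sub_apply, rem_apply_of_le _ _ le_rfl, sub_zero,
        Finsupp.single_eq_same, ofWords_vec F hl]
    · rw [← hs, coeff_polyOfWords, hz, Finsupp.sub_apply, rem_apply_of_le _ _ hj.le, sub_zero,
        Finsupp.single_eq_of_ne (by omega), map_zero]
  refine ⟨z (Γ.height m v - k), ?_⟩
  rw [← coeff_polyOfWords, hs, hs', coeff_C_mul, coeff_revGen F hk]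

theorem IsDescent.mul_mem_range (hm : ∀ v, v = m ∨ Γ.Above v m)
    (hp : Γ.IsDescent m pth) {x : Γ.A F} (hx : x ∈ LinearMap.range (Γ.ofWords F m pth)) (v : V)
    (k : ℕ) : x * (Γ.vertexGen F pth v).coeff k ∈ LinearMap.range (Γ.ofWords F m pth) := by
  obtain ⟨y, rfl⟩ := hx
  induction (wordBasis Γ.Above (Γ.height m) F).mem_span y using Submodule.span_induction with
  | zero => rw [map_zero, zero_mul]; exact zero_mem _
  | add y z _ _ hy hz => rw [map_add, add_mul]; exact add_mem hy hz
  | smul a y _ hy => rw [map_smul, smul_mul_assoc]; exact Submodule.smul_mem _ _ hy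
  | mem y hy =>
    obtain ⟨b, rfl⟩ := hy
    rw [← vec_word, ofWords_vec F b.2, coeff_vertexGen]
    exact hp.wordElt_mul_mem_range F hm b.2 v k

/-- Comparing coefficients of t^j in (edge polynomial) · (polynomial of the head) = (polynomial of
the tail) expresses a_j(e) through vertex coefficients and products a_i(e) · (vertex coefficient)
with i < j. -/
theorem IsDescent.mul_a_mem_range (hm : ∀ v, v = m ∨ Γ.Above v m)
    (hp : Γ.IsDescent m pth) {x : Γ.A F} (hx : x ∈ LinearMap.range (Γ.ofWords F m pth)) (e : E)
    (j : ℕ) : x * Γ.toA F (Γ.a F e j) ∈ LinearMap.range (Γ.ofWords F m pth) := by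
  have hne : Γ.tail e ≠ m := by
    intro h
    have h1 := Γ.rank_lt e
    have h2 := rank_eq_height_add hm (Γ.head e)
    rw [h] at h1
    omega
  induction j using Nat.strong_induction_on with
  | _ j ih =>
    have h := hp.map_pathGen_mul F (.single e) hne
    rw [pathGen_cons, pathGen, List.map_nil, List.prod_nil, mul_one] at h
    have hj := congrArg (fun p => x * p.coeff j) h
    rw [coeff_mul, Finset.Nat.sum_antidiagonal_eq_sum_range_succ_mk, Finset.sum_range_succ,
      Nat.sub_self, coeff_zero_vertexGen, mul_one, mul_add, Finset.mul_sum] at hj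
    simp only [coeff_map, coeff_edgeGen, RingHom.coe_coe, ← mul_assoc] at hj
    rw [eq_sub_of_add_eq' hj]
    refine sub_mem (hp.mul_mem_range F hm hx _ _) (Submodule.sum_mem _ fun i hi => ?_)
    exact hp.mul_mem_range F hm (ih i (Finset.mem_range.1 hi)) _ _

/-- The range contains 1, the image of the empty word, and is stable under right multiplication by
generators. -/
theorem IsDescent.ofWords_surjective (hm : ∀ v, v = m ∨ Γ.Above v m)
    (hp : Γ.IsDescent m pth) : Function.Surjective (Γ.ofWords F m pth) := by
  have key : ∀ (y : FreeAlgebra F Γ.ESharp) (x : Γ.A F),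
      x ∈ LinearMap.range (Γ.ofWords F m pth) →
      x * Γ.toA F y ∈ LinearMap.range (Γ.ofWords F m pth) := by
    intro y
    induction y using FreeAlgebra.induction with
    | grade0 r =>
      intro x hx
      rw [AlgHom.commutes, ← Algebra.commutes, ← Algebra.smul_def]
      exact Submodule.smul_mem _ _ hx
    | grade1 p =>
      intro x hx
      have := hp.mul_a_mem_range F hm hx p.1.1 p.1.2
      rwa [a, if_neg (by have := p.2.1; omega), dif_pos p.2] at this
    | mul y z hy hz =>
      intro x hx
      rw [map_mul, ← mul_assoc]
      exact hz _ (hy _ hx)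
    | add y z hy hz =>
      intro x hx
      rw [map_add, mul_add]
      exact add_mem (hy _ hx) (hz _ hx)
  intro y
  obtain ⟨y, rfl⟩ := RingQuot.mkAlgHom_surjective F (Γ.Rel F) y
  have h1 : (1 : Γ.A F) ∈ LinearMap.range (Γ.ofWords F m pth) :=
    ⟨_, ofWords_vec F (l := []) trivial⟩
  simpa [toA] using key y 1 h1

theorem IsDescent.evalNil_ofWords (hm : ∀ v, v = m ∨ Γ.Above v m)
    (hp : Γ.IsDescent m pth) : evalNil F hm ∘ₗ Γ.ofWords F m pth = LinearMap.id := by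
  refine (wordBasis Γ.Above (Γ.height m) F).ext fun b => ?_
  rw [LinearMap.comp_apply, LinearMap.id_apply, ← vec_word, ofWords_vec F b.2,
    evalNil_wordElt F hm hp b.2]

/-- The basis of `A(Γ)` given by the words. -/
def IsDescent.basis (hm : ∀ v, v = m ∨ Γ.Above v m) (hp : Γ.IsDescent m pth) :
    Module.Basis (Word Γ.Above (Γ.height m)) F (Γ.A F) :=
  (wordBasis Γ.Above (Γ.height m) F).map (LinearEquiv.ofBijective (Γ.ofWords F m pth)
    ⟨Function.LeftInverse.injective (g := evalNil F hm)
      (LinearMap.congr_fun (hp.evalNil_ofWords F hm)), hp.ofWords_surjective F hm⟩)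

theorem IsDescent.basis_apply (hm : ∀ v, v = m ∨ Γ.Above v m) (hp : Γ.IsDescent m pth)
    (b : Word Γ.Above (Γ.height m)) : hp.basis F hm b = Γ.wordElt F pth b.1 := by
  rw [← ofWords_vec F b.2, vec_word]
  rfl

end GenLayeredGraph

end

noncomputable section

/-! ### The basis theorem and the subdivision of an edge -/

namespace LayeredWords

theorem valid_iff {V : Type*} {R : V → V → Prop} {ht : V → ℕ} {l : List (V × ℕ)} :
    Valid R ht l ↔ (∀ p ∈ l, 1 ≤ p.2 ∧ p.2 ≤ ht p.1) ∧
      l.IsChain fun p q => ¬ (R q.1 p.1 ∧ q.2 + ht p.1 = ht q.1) := by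
  induction l with
  | nil => simp [Valid]
  | cons p l ih =>
    rw [Valid, ih, List.isChain_cons, List.forall_mem_cons]
    have : Free R ht p.1 l ↔ ∀ q ∈ l.head?, ¬ (R q.1 p.1 ∧ q.2 + ht p.1 = ht q.1) := by
      cases l <;> simp [Free]
    rw [this]
    tauto

end LayeredWords

namespace GenLayeredGraph

open Polynomial LayeredWords

variable {V E : Type*} {Γ : GenLayeredGraph V E} (F : Type*) [Field F] {m : V} {pth : V → List E}

theorem wordElt_eq_prod (l : List (V × ℕ)) :
    Γ.wordElt F pth l =
      (l.reverse.map fun p => Γ.toA F (Γ.pathCoeff F (pth p.1) p.2)).prod := by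
  induction l with
  | nil => simp [wordElt]
  | cons p l ih => simp [wordElt, ih]

theorem exists_isDescent (hm : ∀ v, v = m ∨ Γ.Above v m) : ∃ pth, Γ.IsDescent m pth := by
  classical
  have h : ∀ v, ∃ π, (v = m → π = []) ∧ (v ≠ m → Γ.IsPath v m π) := by
    intro v
    by_cases hv : v = m
    · exact ⟨[], fun _ => rfl, fun h => absurd hv h⟩
    · obtain ⟨π, hπ⟩ := (hm v).resolve_left hv
      exact ⟨π, fun h => absurd h hv, fun _ => hπ⟩
  choose pth h1 h2 using h
  exact ⟨pth, h1 m rfl, h2⟩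

theorem EdgeChoice.isDescent (c : Γ.EdgeChoice) (hm : ∀ v, Γ.rank v = 0 ↔ v = m) :
    Γ.IsDescent m c.path := by
  refine ⟨by rw [EdgeChoice.path, dif_pos ((hm m).2 rfl)], fun v => ?_⟩
  induction hn : Γ.rank v using Nat.strong_induction_on generalizing v with
  | _ n ih =>
    intro hv
    have h0 : Γ.rank v ≠ 0 := fun h => hv ((hm v).1 h)
    have ht := c.tail_edge v h0
    rw [EdgeChoice.path, dif_neg h0]
    by_cases h : Γ.head (c.edge v h0) = m
    · rw [EdgeChoice.path, dif_pos ((hm _).2 h)]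
      have hs := IsPath.single (Γ := Γ) (c.edge v h0)
      rwa [ht, h] at hs
    · have hlt := Γ.rank_lt (c.edge v h0)
      rw [ht] at hlt
      have hs := IsPath.cons (c.edge v h0) (ih _ (hn ▸ hlt) _ rfl h)
      rwa [ht] at hs

theorem gtrDot_iff (hm : ∀ v, v = m ∨ Γ.Above v m) (p q : V × ℕ) :
    Γ.GtrDot p q ↔ Γ.Above p.1 q.1 ∧ p.2 + Γ.height m q.1 = Γ.height m p.1 := by
  have := rank_eq_height_add hm p.1
  have := rank_eq_height_add hm q.1
  rw [GtrDot]
  refine and_congr_right fun _ => ?_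
  omega

theorem valid_of_mem_B (hm : ∀ v, v = m ∨ Γ.Above v m) (h0 : Γ.rank m = 0) {b : List Γ.VSharp}
    (hb : b ∈ Γ.B) : Valid Γ.Above (Γ.height m) (b.map Subtype.val).reverse := by
  refine valid_iff.2 ⟨fun p hp => ?_, ?_⟩
  · rw [List.mem_reverse, List.mem_map] at hp
    obtain ⟨q, -, rfl⟩ := hp
    rw [height, h0]
    exact q.2
  · rw [List.isChain_reverse, List.isChain_map]
    exact List.IsChain.imp (fun p q h h' => h ((gtrDot_iff hm _ _).2 h')) hb

theorem exists_mem_B (hm : ∀ v, v = m ∨ Γ.Above v m) (h0 : Γ.rank m = 0) {l : List (V × ℕ)}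
    (hl : Valid Γ.Above (Γ.height m) l) :
    ∃ b ∈ Γ.B, (b.map Subtype.val).reverse = l := by
  obtain ⟨h1, h2⟩ := valid_iff.1 hl
  simp only [height, h0, Nat.sub_zero] at h1
  obtain ⟨b, hb⟩ : ∃ b : List Γ.VSharp, b.map Subtype.val = l.reverse := by
    have : ∀ p ∈ l.reverse, 1 ≤ p.2 ∧ p.2 ≤ Γ.rank p.1 := by simpa using h1
    lift l.reverse to List Γ.VSharp using this with b
    exact ⟨b, rfl⟩
  refine ⟨b, ?_, by rw [hb, List.reverse_reverse]⟩
  rw [← List.reverse_reverse l, ← hb, List.isChain_reverse, List.isChain_map] at h2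
  exact List.IsChain.imp (fun p q h h' => h ((gtrDot_iff hm _ _).1 h')) h2

theorem EdgeChoice.eps_eq_wordElt (c : Γ.EdgeChoice) (b : List Γ.VSharp) :
    c.eps F b = Γ.wordElt F c.path (b.map Subtype.val).reverse := by
  rw [wordElt_eq_prod, List.reverse_reverse, List.map_map]
  rfl

theorem EdgeChoice.linearIndependent_eps (c : Γ.EdgeChoice) (hm : ∀ v, v = m ∨ Γ.Above v m)
    (h0 : ∀ v, Γ.rank v = 0 ↔ v = m) : LinearIndependent F fun b : Γ.B => c.eps F b.1 := by
  have h := ((c.isDescent h0).basis F hm).linearIndependent.comp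
    (fun b : Γ.B => ⟨_, valid_of_mem_B hm ((h0 m).2 rfl) b.2⟩) fun b b' hb => Subtype.ext
      (List.map_injective_iff.2 Subtype.val_injective
        (List.reverse_injective (congrArg Subtype.val hb)))
  convert h using 2 with b
  rw [Function.comp_apply, IsDescent.basis_apply, eps_eq_wordElt]

theorem EdgeChoice.span_eps (c : Γ.EdgeChoice) (hm : ∀ v, v = m ∨ Γ.Above v m)
    (h0 : ∀ v, Γ.rank v = 0 ↔ v = m) : Submodule.span F (c.eps F '' Γ.B) = ⊤ := by
  rw [eq_top_iff, ← ((c.isDescent h0).basis F hm).span_eq]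
  refine Submodule.span_mono ?_
  rintro _ ⟨l, rfl⟩
  obtain ⟨b, hb, hl⟩ := exists_mem_B hm ((h0 m).2 rfl) l.2
  exact ⟨b, hb, by rw [IsDescent.basis_apply, eps_eq_wordElt, hl]⟩

/-! ### Injectivity of ι for a subdivided edge -/

section Subdivision

variable {F} {e : E} {i : ℕ} {hi : 0 < i} {hil : i < Γ.len e}

theorem above_addVertex {v w : V} (h : Γ.Above v w) :
    (Γ.addVertex e i hi hil).Above (some v) (some w) :=
  ⟨_, Γ.isPath_subPath e i hi hil h.choose_spec⟩

/-- The new vertex can only be entered by the first half of `e` and left by the second. Paths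
starting at the new vertex must be carried along in the induction to glue the halves back together.
-/
theorem IsPath.of_addVertex {x y : Option V} {π : List (SubEdge e)}
    (h : (Γ.addVertex e i hi hil).IsPath x y π) {w : V} (hy : y = some w) :
    (∀ v, x = some v → Γ.Above v w) ∧ (x = none → Γ.head e = w ∨ Γ.Above (Γ.head e) w) := by
  induction h with
  | single f =>
    cases f with
    | old f hf =>
      obtain rfl := Option.some.inj hy
      refine ⟨fun v hv => ?_, fun h => by cases h⟩
      obtain rfl := Option.some.inj hv
      exact Γ.above_edge f
    | fst => cases hy
    | snd => exact ⟨fun v hv => (by cases hv), fun _ => .inl (Option.some.inj hy)⟩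
  | cons f _ ih =>
    obtain ⟨ih1, ih2⟩ := ih hy
    cases f with
    | old f hf =>
      refine ⟨fun v hv => ?_, fun h => by cases h⟩
      obtain rfl := Option.some.inj hv
      exact (Γ.above_edge f).trans (ih1 _ rfl)
    | fst =>
      refine ⟨fun v hv => ?_, fun h => by cases h⟩
      obtain rfl := Option.some.inj hv
      rcases ih2 rfl with rfl | h
      exacts [Γ.above_edge e, (Γ.above_edge e).trans h]
    | snd => exact ⟨fun v hv => (by cases hv), fun _ => .inr (ih1 _ rfl)⟩

theorem above_addVertex_iff {v w : V} :
    (Γ.addVertex e i hi hil).Above (some v) (some w) ↔ Γ.Above v w :=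
  ⟨fun ⟨_, h⟩ => (h.of_addVertex rfl).1 v rfl, above_addVertex⟩

theorem eq_or_above_addVertex (hm : ∀ v, v = m ∨ Γ.Above v m) (x : Option V) :
    x = some m ∨ (Γ.addVertex e i hi hil).Above x (some m) := by
  cases x with
  | some v => exact (hm v).imp (congrArg some) above_addVertex
  | none =>
    have h : (Γ.addVertex e i hi hil).Above none (some (Γ.head e)) :=
      (Γ.addVertex e i hi hil).above_edge .snd
    right
    rcases hm (Γ.head e) with h' | h'
    · rwa [h'] at h
    · exact h.trans (above_addVertex h')

/-- Subdivision changes neither the order nor the heights of old vertices, so no new forbidden pair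
arises among old letters. -/
theorem valid_addVertex {l : List (V × ℕ)} (hl : Valid Γ.Above (Γ.height m) l) :
    Valid (Γ.addVertex e i hi hil).Above ((Γ.addVertex e i hi hil).height (some m))
      (l.map (Prod.map some id)) := by
  rw [valid_iff] at hl ⊢
  refine ⟨fun p hp => ?_, ?_⟩
  · obtain ⟨q, hq, rfl⟩ := List.mem_map.1 hp
    exact hl.1 q hq
  · rw [List.isChain_map]
    refine hl.2.imp fun p q hpq h => hpq ⟨above_addVertex_iff.1 h.1, h.2⟩

theorem iota_toA (x : FreeAlgebra F Γ.ESharp) :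
    Γ.iota F e i hi hil (Γ.toA F x) =
      (Γ.addVertex e i hi hil).toA F (Γ.iotaTilde F e i hi hil x) :=
  RingQuot.liftAlgHom_mkAlgHom_apply ..

theorem iota_wordElt (hp : Γ.IsDescent m pth) {pth' : Option V → List (SubEdge e)}
    (hp' : (Γ.addVertex e i hi hil).IsDescent (some m) pth') (l : List (V × ℕ)) :
    Γ.iota F e i hi hil (Γ.wordElt F pth l) =
      (Γ.addVertex e i hi hil).wordElt F pth' (l.map (Prod.map some id)) := by
  induction l with
  | nil => exact map_one _
  | cons p l ih =>
    rw [List.map_cons, wordElt, wordElt, map_mul, ih, iota_toA, iotaTilde_pathCoeff]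
    congr 1
    dsimp only [Prod.map, id]
    by_cases h : p.1 = m
    · rw [h, hp.1, hp'.1]
      rfl
    -- The subdivided path need not be the one chosen in the new graph, but the relations identify
    -- their coefficients.
    · have := congrArg (fun q => q.coeff p.2) ((Γ.isPath_subPath e i hi hil
        (hp.2 _ h)).map_pathGen_eq F (hp'.2 (some p.1) fun h' => h (Option.some.inj h')))
      simp only [coeff_map, coeff_pathGen] at this
      exact this

theorem iota_injective (hm : ∀ v, v = m ∨ Γ.Above v m) :
    Function.Injective (Γ.iota F e i hi hil) := by
  obtain ⟨pth, hp⟩ := exists_isDescent hm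
  have hm' := eq_or_above_addVertex (hi := hi) (hil := hil) hm
  obtain ⟨pth', hp'⟩ := exists_isDescent hm'
  have h := (hp'.basis F hm').linearIndependent.comp
    (fun b : Word Γ.Above (Γ.height m) => ⟨_, valid_addVertex (hi := hi) (hil := hil) b.2⟩)
    fun b b' hb => Subtype.ext (List.map_injective_iff.2
      (Function.Injective.prodMap (Option.some_injective V) Function.injective_id)
      (congrArg Subtype.val hb))
  refine LinearMap.injective_of_linearIndependent (f := (Γ.iota F e i hi hil).toLinearMap)
    (hp.basis F hm).span_eq ?_
  have hcomp : (Γ.iota F e i hi hil).toLinearMap ∘ hp.basis F hm = hp'.basis F hm' ∘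
      fun b => ⟨_, valid_addVertex b.2⟩ := by
    funext b
    rw [Function.comp_apply, Function.comp_apply, IsDescent.basis_apply, IsDescent.basis_apply]
    exact iota_wordElt hp hp' b.1
  rw [hcomp]
  exact h

end Subdivision

end GenLayeredGraph

end

theorem theorem3p2 {F : Type*} [Field F] {V E : Type*} (Γ : GenLayeredGraph V E)
    (hΓ : ∃! v, Γ.IsMinimal v) :
    ((∀ v, Γ.rank v = 0 ↔ Γ.IsMinimal v) → ∀ c : Γ.EdgeChoice,
      LinearIndependent F (fun b : Γ.B => c.eps F b.1) ∧
      Submodule.span F (c.eps F '' Γ.B) = ⊤) ∧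
    ∀ (e : E) (i : ℕ) (hi : 0 < i) (hil : i < Γ.len e),
      Function.Injective (Γ.iota F e i hi hil) := by
  obtain ⟨m, hmin, huniq⟩ := hΓ
  have hm := GenLayeredGraph.eq_or_above huniq
  refine ⟨fun h c => ?_, fun e i hi hil => GenLayeredGraph.iota_injective hm⟩
  have h0 : ∀ v, Γ.rank v = 0 ↔ v = m := fun v =>
    (h v).trans ⟨huniq v, fun hv => hv ▸ hmin⟩
  exact ⟨c.linearIndependent_eps F hm h0, c.span_eps F hm h0⟩
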